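/- Let $G$ be a finite simple graph with vertex set $V$, and fix a total order on $V$. **Symmetric functions.** A proper set coloring of $G$ assigns to each vertex $v$ a nonempty finite set $\kappa(v)\subset\mathbb{Z}_{>0}$ so that adjacent vertices get disjoint sets. The Kromatic symmetric function is $\overline{X}_G=\sum_{\kappa}\prod_{v\in V}\prod_{i\in\kappa(v)}x_i$, the sum being over all proper set colorings. For $k\ge 1$ let $\overline{p}_k=\prod_{i\ge1}(1+x_i^k)-1$, and for a partition $\lambda=(\lambda_1,\dots,\lambda_{\ell(\lambda)})$ let $\overline{p}_\lambda=\overline{p}_{\lambda_1}\cdots\overline{p}_{\lambda_{\ell(\lambda)}}$. **Heaps.** A heap on $G$ is an equivalence class of words over $V$, where neighboring letters that are distinct nonadjacent vertices may be exchanged; heaps form a monoid under concatenation $\circ$. The pieces of the heap of a word are its letters (with repetition), its size is the number of pieces, and it uses the vertices that occur as letters. Between two pieces whose vertices are equal or adjacent there is an arrow from the earlier to the later one. A pyramid is a heap with exactly one piece that receives no arrow. A heap is periodic if it equals $K^k$ for some heap $K$ and some $k>1$. For a piece $p$ of $H$ write $H=U\circ W$, where $W$ consists of the pieces reachable from $p$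 along arrows, and put $A_p(H)=W\circ U$; for a pyramid $H$ the sequence $A_p^n(H)$ is eventually constant, and its eventual value is called the rotation of $H$ at $p$. The standard word of a heap is the lexicographically largest word in its class, and heaps are ordered by comparing standard words lexicographically. A Lyndon heap is an aperiodic pyramid that is minimal among all its rotations. **Theorem.** There is a unique family of rational numbers $([\overline{p}_\lambda]\overline{X}_G)_\lambda$, indexed by all partitions $\lambda$, with $\overline{X}_G=\sum_\lambda\big([\overline{p}_\lambda]\overline{X}_G\big)\,\overline{p}_\lambda$ (for each monomial only finitely many terms contribute). For every partition $\lambda$, the number $$(-1)^{|\lambda|-\ell(\lambda)}\,[\overline{p}_\lambda]\overline{X}_G$$ equals the (finite) number of multisets $\{(\lambda_1,L_1),\dots,(\lambda_{\ell(\lambda)},L_{\ell(\lambda)})\}$, i.e. multisets of Lyndon heaps on $G$ in which the heap $L_i$ is attached to the part $\lambda_i$ (heaps attached to equal parts being unordered), such that 1. every vertex of $G$ is used by at least one $L_i$; 2. each $L_i$ has size $\lambda_i$, or has some even size $\lambda_i/2^j$ with $j\ge1$; 3. the heaps attached to equal odd parts of $\lambda$ are pairwise distinct. In particular all the coefficients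 are integers, and $[\overline{p}_\lambda]\overline{X}_G$ is zero or has sign $(-1)^{|\lambda|-\ell(\lambda)}$. -/

import Mathlib

noncomputable section

namespace Kromatic

/-! ### Set colorings and the Kromatic symmetric function

The variables `x₁, x₂, …` are indexed by `ℕ`, and so are the colors. -/

section Symmetric

variable {V : Type*} [Fintype V]

/-- A proper set coloring: every vertex gets a nonempty (finite) set of colors, and adjacent
vertices get disjoint sets of colors. -/
def IsProperSetColoring (G : SimpleGraph V) (κ : V → Finset ℕ) : Prop :=
  (∀ v, (κ v).Nonempty) ∧ ∀ u v, G.Adj u v → Disjoint (κ u) (κ v)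

/-- The exponent vector of the monomial `∏ v, ∏ i ∈ κ v, x i`. -/
def colorWeight (κ : V → Finset ℕ) : ℕ →₀ ℕ :=
  ∑ v, ∑ i ∈ κ v, Finsupp.single i 1

/-- Only finitely many set colorings contribute to a given monomial. -/
theorem finite_colorWeight_eq (m : ℕ →₀ ℕ) :
    {κ : V → Finset ℕ | colorWeight κ = m}.Finite := by
  classical
  refine (Set.Finite.pi' (fun _ : V => (m.support.powerset : Finset (Finset ℕ)).finite_toSet)).subset
    ?_
  rintro κ rfl v
  simp only [Finset.coe_powerset, Set.mem_preimage, Set.mem_powerset_iff, Finset.coe_subset]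
  intro i hi
  rw [Finsupp.mem_support_iff]
  intro h0
  simp only [colorWeight, Finsupp.finsetSum_apply] at h0
  have h1 := (Finset.sum_eq_zero_iff.mp h0) v (Finset.mem_univ v)
  have h2 := (Finset.sum_eq_zero_iff.mp h1) i hi
  simp at h2

/-- The Kromatic symmetric function `∑ κ, ∏ v, ∏ i ∈ κ v, x i`, the sum being over all proper set
colorings `κ`: the coefficient of a monomial is the number of proper set colorings giving it. -/
def kromatic (G : SimpleGraph V) : MvPowerSeries ℕ ℚ := fun m =>
  (Nat.card {κ : V → Finset ℕ // IsProperSetColoring G κ ∧ colorWeight κ = m} : ℚ)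

/-- The `K`-theoretic power sum `p̄ k = ∏ i, (1 + x i ^ k) - 1`, i.e. the sum of the monomials
`∏ i ∈ S, x i ^ k` over all nonempty finite sets `S` of variables. The theorem `hasProd_pbar`
shows the product formula. -/
def pbar (k : ℕ) : MvPowerSeries ℕ ℚ := fun m =>
  open Classical in if m ≠ 0 ∧ ∀ i ∈ m.support, m i = k then 1 else 0

open scoped MvPowerSeries.WithPiTopology in
/-- `1 + p̄ k = ∏ i, (1 + x i ^ k)`. -/
theorem hasProd_pbar (k : ℕ) (hk : 0 < k) :
    HasProd (fun i : ℕ => (1 + MvPowerSeries.X i ^ k : MvPowerSeries ℕ ℚ)) (1 + pbar k) := by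
  classical
  rw [HasProd, MvPowerSeries.WithPiTopology.tendsto_iff_coeff_tendsto]
  intro m
  refine tendsto_const_nhds.congr' ?_
  filter_upwards [Filter.eventually_ge_atTop m.support] with S hS
  have hmon : ∀ t : Finset ℕ, (∏ i ∈ t, (MvPowerSeries.X i ^ k : MvPowerSeries ℕ ℚ)) =
      MvPowerSeries.monomial (∑ i ∈ t, Finsupp.single i k) 1 := by
    intro t
    induction t using Finset.induction_on with
    | empty => simp [MvPowerSeries.monomial_zero_one]
    | insert a t ha ih =>
      rw [Finset.prod_insert ha, Finset.sum_insert ha, ih, MvPowerSeries.X_pow_eq,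
        MvPowerSeries.monomial_mul_monomial, one_mul]
  have happ : ∀ (t : Finset ℕ) (j : ℕ),
      (∑ i ∈ t, Finsupp.single i k : ℕ →₀ ℕ) j = if j ∈ t then k else 0 := by
    intro t j
    simp [Finsupp.finsetSum_apply, Finsupp.single_apply]
  have hiff : ∀ t : Finset ℕ, m = ∑ i ∈ t, Finsupp.single i k ↔
      t = m.support ∧ ∀ i ∈ m.support, m i = k := by
    intro t
    constructor
    · rintro rfl
      have hs : t = (∑ i ∈ t, Finsupp.single i k : ℕ →₀ ℕ).support := by
        ext j
        rw [Finsupp.mem_support_iff, happ]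
        by_cases hj : j ∈ t <;> simp [hj, hk.ne']
      refine ⟨hs, fun i hi => ?_⟩
      rw [← hs] at hi
      rw [happ, if_pos hi]
    · rintro ⟨rfl, h⟩
      ext j
      rw [happ]
      by_cases hj : j ∈ m.support
      · rw [if_pos hj, h j hj]
      · rw [if_neg hj]
        simpa using hj
  have hL : MvPowerSeries.coeff m (1 + pbar k) =
      if ∀ i ∈ m.support, m i = k then (1 : ℚ) else 0 := by
    rw [map_add, MvPowerSeries.coeff_one]
    change _ + (if m ≠ 0 ∧ ∀ i ∈ m.support, m i = k then (1 : ℚ) else 0) = _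
    by_cases hm : m = 0
    · subst hm; simp
    · simp [hm]
  rw [hL, Finset.prod_one_add, map_sum]
  simp only [hmon, MvPowerSeries.coeff_monomial, hiff]
  by_cases h : ∀ i ∈ m.support, m i = k
  · rw [if_pos h, Finset.sum_eq_single m.support]
    · rw [if_pos ⟨rfl, h⟩]
    · intro t _ ht
      rw [if_neg fun h' => ht h'.1]
    · intro ht
      exact absurd (Finset.mem_powerset.mpr hS) ht
  · rw [if_neg h, Finset.sum_eq_zero]
    intro t _
    rw [if_neg fun h' => h h'.2]

/-- `p̄ λ = p̄ λ₁ ⋯ p̄ λ_ℓ`. -/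
def pbarPart {n : ℕ} (μ : n.Partition) : MvPowerSeries ℕ ℚ :=
  (μ.parts.map pbar).prod

/-- `f = ∑ λ, c λ • p̄ λ`, a sum over all partitions of all sizes `n`, taken coefficientwise:
for each monomial the sum has finitely many nonzero terms. -/
def IsPbarExpansion (f : MvPowerSeries ℕ ℚ) (c : (n : ℕ) → n.Partition → ℚ) : Prop :=
  ∀ m : ℕ →₀ ℕ,
    (Function.support fun x : Σ n : ℕ, n.Partition =>
      c x.1 x.2 * MvPowerSeries.coeff m (pbarPart x.2)).Finite ∧
    MvPowerSeries.coeff m f =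
      ∑ᶠ x : Σ n : ℕ, n.Partition, c x.1 x.2 * MvPowerSeries.coeff m (pbarPart x.2)

end Symmetric

/-! ### Heaps

A heap on `G` is a word in the vertices, up to exchanging neighboring letters that are distinct
nonadjacent vertices. The pieces of the heap of a word `w` are the positions in `w`, and `Arrow`
is the corresponding acyclic orientation of the clan graph. -/

section Heaps

variable {V : Type*}

/-- Distinct nonadjacent vertices commute. -/
inductive CommRel (G : SimpleGraph V) : FreeMonoid V → FreeMonoid V → Prop
  | swap (u v : V) (hne : u ≠ v) (hadj : ¬ G.Adj u v) :
      CommRel G (FreeMonoid.of u * FreeMonoid.of v) (FreeMonoid.of v * FreeMonoid.of u)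

/-- Heaps on `G`: the free partially commutative monoid, whose product is the composition. -/
abbrev Heap (G : SimpleGraph V) : Type _ := PresentedMonoid (CommRel G)

/-- The heap of a word. -/
def Heap.ofWord (G : SimpleGraph V) (w : List V) : Heap G :=
  PresentedMonoid.mk (CommRel G) (FreeMonoid.ofList w)

/-- The type of a heap: the multiset of vertices of its pieces. -/
def Heap.type {G : SimpleGraph V} (H : Heap G) : Multiset V :=
  Multiplicative.toAdd (PresentedMonoid.lift (rels := CommRel G)
    (fun v => Multiplicative.ofAdd ({v} : Multiset V))
    (by
      rintro _ _ ⟨u, v, -, -⟩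
      simp [mul_comm]) H)

/-- The type of the heap of a word is the multiset of its letters. -/
theorem Heap.type_ofWord (G : SimpleGraph V) (w : List V) :
    (Heap.ofWord G w).type = (w : Multiset V) := by
  induction w with
  | nil => rfl
  | cons a l ih =>
    have h : Heap.ofWord G (a :: l) = PresentedMonoid.of (CommRel G) a * Heap.ofWord G l := by
      rw [Heap.ofWord, FreeMonoid.ofList_cons, map_mul]
      rfl
    rw [← Multiset.cons_coe, ← ih, h, Heap.type, map_mul, PresentedMonoid.lift_of, toAdd_mul,
      toAdd_ofAdd, Multiset.singleton_add]
    rfl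

/-- The size of a heap: the number of its pieces. -/
def Heap.size {G : SimpleGraph V} (H : Heap G) : ℕ := Multiset.card H.type

/-- The orientation on the pieces of the heap of `w`: two pieces are joined when their vertices
are equal or adjacent, and the edge points from the earlier to the later one. -/
def Arrow (G : SimpleGraph V) (w : List V) (i j : Fin w.length) : Prop :=
  i < j ∧ (w.get i = w.get j ∨ G.Adj (w.get i) (w.get j))

/-- A pyramid is a heap with a unique source. -/
def Heap.IsPyramid {G : SimpleGraph V} (H : Heap G) : Prop :=
  ∃ w : List V, Heap.ofWord G w = H ∧ ∃! i : Fin w.length, ∀ j, ¬ Arrow G w j i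

/-- A heap is periodic if it is a `k`-fold power of a heap for some `k > 1`. -/
def Heap.IsPeriodic {G : SimpleGraph V} (H : Heap G) : Prop :=
  ∃ (K : Heap G) (k : ℕ), 1 < k ∧ K ^ k = H

/-- The subword of `w` at the positions in `S`. -/
def subword (w : List V) (S : Set (Fin w.length)) : List V :=
  open Classical in ((List.finRange w.length).filter (fun i => i ∈ S)).map w.get

/-- The pyramid determined by the piece `p`: all pieces reachable from it by directed paths. -/
def reach (G : SimpleGraph V) (w : List V) (p : Fin w.length) : Set (Fin w.length) :=
  {j | Relation.ReflTransGen (Arrow G w) p j}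

theorem subword_reach_length_pos (G : SimpleGraph V) (w : List V) (p : Fin w.length) :
    0 < (subword w (reach G w p)).length := by
  classical
  refine List.length_pos_of_mem (a := w.get p) (List.mem_map.mpr ⟨p, ?_, rfl⟩)
  have h : p ∈ reach G w p := Relation.ReflTransGen.refl
  simpa using h

/-- The operation `A_p : U ∘ W ↦ W ∘ U` on a heap with a marked piece `p`, where `W` is the pyramid
determined by `p` and `U` consists of all other pieces. As `p` precedes all pieces reachable from
it, it is the first letter of the new word. -/
def rotateStep (G : SimpleGraph V) (x : Σ w : List V, Fin w.length) :
    Σ w : List V, Fin w.length :=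
  ⟨subword x.1 (reach G x.1 x.2) ++ subword x.1 (reach G x.1 x.2)ᶜ,
    ⟨0, by
      rw [List.length_append]
      exact Nat.add_pos_left (subword_reach_length_pos G x.1 x.2) _⟩⟩

/-- `K` is a rotation of `H`: for some piece `p` of `H`, the sequence `A_p^n(H)` is eventually
constant, equal to `K`. -/
def Heap.IsRotation {G : SimpleGraph V} (H K : Heap G) : Prop :=
  ∃ (w : List V) (p : Fin w.length), Heap.ofWord G w = H ∧
    ∃ N : ℕ, ∀ n ≥ N, Heap.ofWord G ((rotateStep G)^[n] ⟨w, p⟩).1 = K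

/-- `w` is the standard word of `H`: the lexicographically maximal one among its words. -/
def Heap.IsStandardWord [LinearOrder V] {G : SimpleGraph V} (H : Heap G) (w : List V) : Prop :=
  Heap.ofWord G w = H ∧ ∀ u : List V, Heap.ofWord G u = H → u ≤ w

/-- The total order on heaps: compare standard words lexicographically. -/
def Heap.StdLE [LinearOrder V] {G : SimpleGraph V} (H K : Heap G) : Prop :=
  ∃ u w : List V, H.IsStandardWord u ∧ K.IsStandardWord w ∧ u ≤ w

/-- A Lyndon heap is an aperiodic pyramid which is minimal among its rotations. -/
def Heap.IsLyndon [LinearOrder V] {G : SimpleGraph V} (H : Heap G) : Prop :=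
  H.IsPyramid ∧ ¬ H.IsPeriodic ∧ ∀ K : Heap G, H.IsRotation K → H.StdLE K

/-- The multisets `{L₁, …, L_ℓ}` of Lyndon heaps, `L_i` being attached to the part `μ_i`, that
together use every vertex, such that `L_i` has size `μ_i` or some even size `μ_i / 2 ^ j` with
`j ≥ 1`, and the heaps attached to a repeated odd part are distinct. Each is recorded as the
multiset of the pairs `(μ_i, L_i)`. -/
def lyndonCoverings [LinearOrder V] (G : SimpleGraph V) {n : ℕ} (μ : n.Partition) :
    Set (Multiset (ℕ × Heap G)) :=
  {P | P.map Prod.fst = μ.parts ∧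
    (∀ x ∈ P, x.2.IsLyndon ∧
      (x.2.size = x.1 ∨ Even x.2.size ∧ ∃ j : ℕ, 1 ≤ j ∧ x.1 = 2 ^ j * x.2.size)) ∧
    (∀ k : ℕ, Odd k → (P.filter fun x => x.1 = k).Nodup) ∧
    ∀ v : V, ∃ x ∈ P, v ∈ x.2.type}

end Heaps

end Kromatic

end

/-! For a set W of vertices let I_W(x) be the independence polynomial of the subgraph induced on W.
If empty color sets are allowed, the set colorings supported in W can be read color by color: the
vertices carrying a given color form an independent set, so the generating function is the product
of I_W(x_i) over all variables. Inclusion and exclusion over W then recovers the Kromatic function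
(`coeff_kromatic_eq_sum`), and becomes condition 1 of the theorem. It remains to factor I_W.

Let F and P be the generating functions, by size, of the heaps and of the pyramids on W. Cartier and
Foata's inversion says I_W(-x) F(x) = 1 (`sum_indepOn_mul_heapsOn`). Cutting a heap at a marked
piece gives x F' = F P (`mul_card_heapsOn`). A pyramid is a power of a unique aperiodic pyramid
(`card_pyrOn`), and the aperiodic pyramids of size n fall into conjugacy classes of n elements, one
for each piece of the unique Lyndon heap in the class (`card_apyrOn`). So P is the sum of |L| x^|L|
/ (1 - x^|L|) over Lyndon heaps L, and integrating the logarithmic derivative yields I_W(x) = ∏ (1 -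
(-x)^|L|) (`truncEq_indepSeries`).

A heap of odd size s gives the factor 1 + x^s. One of even size gives 1 - x^s, the inverse of the
product of all 1 + x^(2^j s) with j ≥ 0; this is where the sizes in condition 2 come from. Taking
the product over all variables turns 1 + x^k into 1 + p̄_k. Odd k appear as factors 1 + p̄_k, so
each pair is used at most once (condition 3); even k appear as 1 / (1 + p̄_k), a geometric series in
-p̄_k, so multiplicities are free and each part carries the sign -1. The total sign is (-1)^(|λ| -
ℓ(λ)).

The bijections rest on left cancellation and Levi's lemma for heaps. Rotations, defined by a process
on words, are identified with conjugate pyramids in `isRotation_iff`. Uniqueness of the coefficients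
holds because the lowest-degree part of p̄_λ is the power sum p_λ, which is triangular with respect
to the number of parts. -/

namespace Kromatic

/-! ### The free partially commutative monoid -/

section Trace

variable {V : Type*} {G : SimpleGraph V}

/-- Distinct nonadjacent vertices. -/
def Indep (G : SimpleGraph V) (u v : V) : Prop := u ≠ v ∧ ¬ G.Adj u v

theorem Indep.symm {u v : V} (h : Indep G u v) : Indep G v u :=
  ⟨h.1.symm, fun h' => h.2 h'.symm⟩

theorem not_indep_self (v : V) : ¬ Indep G v v := fun h => h.1 rfl

/-- The heap with a single piece. -/
def piece (G : SimpleGraph V) (v : V) : Heap G := PresentedMonoid.of (CommRel G) v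

theorem piece_comm {u v : V} (h : Indep G u v) :
    piece G u * piece G v = piece G v * piece G u :=
  PresentedMonoid.mk_eq_mk_of_rel (CommRel.swap u v h.1 h.2)

namespace Heap

@[simp] theorem ofWord_nil : ofWord G ([] : List V) = 1 := rfl

@[simp] theorem ofWord_cons (v : V) (w : List V) : ofWord G (v :: w) = piece G v * ofWord G w := rfl

theorem exists_ofWord (H : Heap G) : ∃ w : List V, ofWord G w = H :=
  PresentedMonoid.surjective_mk H

theorem cons_induction {P : Heap G → Prop} (one : P 1)
    (cons : ∀ v H, P H → P (piece G v * H)) (H : Heap G) : P H := by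
  obtain ⟨w, rfl⟩ := exists_ofWord H
  induction w with
  | nil => exact one
  | cons v w ih => exact cons v _ ih

@[simp] theorem type_one : (1 : Heap G).type = 0 := rfl

@[simp] theorem type_mul (H K : Heap G) : (H * K).type = H.type + K.type := by
  simp only [type, map_mul, toAdd_mul]

@[simp] theorem type_piece (v : V) : (piece G v).type = {v} := rfl

@[simp] theorem type_pow (H : Heap G) (n : ℕ) : (H ^ n).type = n • H.type := by
  induction n with
  | zero => simp
  | succ n ih => rw [pow_succ, type_mul, ih, succ_nsmul]

@[simp] theorem size_one : (1 : Heap G).size = 0 := rfl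

@[simp] theorem size_mul (H K : Heap G) : (H * K).size = H.size + K.size := by
  simp [size]

@[simp] theorem size_piece (v : V) : (piece G v).size = 1 := rfl

@[simp] theorem size_pow (H : Heap G) (n : ℕ) : (H ^ n).size = n * H.size := by
  simp [size]

@[simp] theorem size_ofWord (w : List V) : (ofWord G w).size = w.length := by
  rw [size, type_ofWord, Multiset.coe_card]

theorem eq_one_of_size_eq_zero {H : Heap G} (h : H.size = 0) : H = 1 := by
  obtain ⟨w, rfl⟩ := exists_ofWord H
  cases w with
  | nil => rfl
  | cons v w => simp at h

theorem size_eq_zero {H : Heap G} : H.size = 0 ↔ H = 1 :=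
  ⟨eq_one_of_size_eq_zero, by rintro rfl; rfl⟩

theorem size_pos {H : Heap G} (h : H ≠ 1) : 0 < H.size :=
  Nat.pos_of_ne_zero fun h' => h (size_eq_zero.1 h')

theorem eq_one_of_type_eq_zero {H : Heap G} (h : H.type = 0) : H = 1 :=
  eq_one_of_size_eq_zero (by simp [size, h])

theorem mul_eq_one {H K : Heap G} (h : H * K = 1) : H = 1 ∧ K = 1 := by
  have := congrArg size h
  rw [size_mul, size_one] at this
  exact ⟨eq_one_of_size_eq_zero (by omega), eq_one_of_size_eq_zero (by omega)⟩

/-! ### Left division by a piece -/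

section

open Classical in
/-- The action of a letter on pairs `(H, leftDiv a H)`. -/
noncomputable def divStep (a b : V) : Function.End (Heap G × Option (Heap G)) := fun x =>
  (piece G b * x.1,
    if b = a then some x.1 else if G.Adj a b then none else x.2.map (piece G b * ·))

/-- Left division is computed letter by letter on a word; compatibility with the commutation
relations makes it well defined on heaps. The undivided heap is carried along because it is the
answer when the letter equals `a`. -/
theorem divStep_comm (a : V) {u v : V} (h : Indep G u v) :
    divStep (G := G) a u * divStep a v = divStep a v * divStep a u := by
  classical
  funext x
  obtain ⟨H, d⟩ := x
  have hc : ∀ K : Heap G, piece G u * (piece G v * K) = piece G v * (piece G u * K) := fun K => by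
    rw [← mul_assoc, piece_comm h, mul_assoc]
  have hne := h.1
  have hna := h.2
  have hna' := h.symm.2
  change divStep a u (divStep a v (H, d)) = divStep a v (divStep a u (H, d))
  simp only [divStep, hc, Prod.mk.injEq, true_and]
  by_cases hu : u = a
  · subst hu
    simp [hne.symm, hna]
  · by_cases hv : v = a
    · subst hv
      simp [hu, hna']
    · by_cases hau : G.Adj a u <;> by_cases hav : G.Adj a v <;>
        simp [hu, hv, hau, hav, Function.comp_def, hc]

/-- The action of heaps on pairs `(H, leftDiv a H)`. -/
noncomputable def divHom (a : V) : Heap G →* Function.End (Heap G × Option (Heap G)) :=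
  PresentedMonoid.lift (rels := CommRel G) (divStep a) (by
    rintro _ _ ⟨u, v, hne, hadj⟩
    simpa using divStep_comm a ⟨hne, hadj⟩)

/-- `leftDiv a H` is the heap `K` with `H = a ∘ K`, if there is one. -/
noncomputable def leftDiv (a : V) (H : Heap G) : Option (Heap G) := (divHom a H (1, none)).2

theorem divHom_piece_mul (a b : V) (H : Heap G) (x : Heap G × Option (Heap G)) :
    divHom a (piece G b * H) x = divStep a b (divHom a H x) := by
  rw [map_mul]
  rfl

theorem divHom_fst (a : V) (H : Heap G) : (divHom a H (1, none)).1 = H := by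
  induction H using cons_induction with
  | one => rfl
  | cons v H ih => rw [divHom_piece_mul, divStep, ih]

theorem leftDiv_one (a : V) : leftDiv a (1 : Heap G) = none := rfl

open Classical in
theorem leftDiv_piece_mul (a b : V) (H : Heap G) : leftDiv a (piece G b * H) =
    if b = a then some H else if G.Adj a b then none else (leftDiv a H).map (piece G b * ·) := by
  rw [leftDiv, divHom_piece_mul, divStep, divHom_fst]
  rfl

theorem leftDiv_eq_some {a : V} {H K : Heap G} : leftDiv a H = some K ↔ H = piece G a * K := by
  constructor
  · induction H using cons_induction generalizing K with
    | one => simp [leftDiv_one]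
    | cons b H ih =>
      rw [leftDiv_piece_mul]
      split_ifs with h1 h2
      · rintro ⟨⟩
        rw [h1]
      · simp
      · intro h
        obtain ⟨L, hL, rfl⟩ := Option.map_eq_some_iff.1 h
        rw [ih hL, ← mul_assoc, ← mul_assoc, piece_comm ⟨h1, fun h => h2 h.symm⟩]
  · rintro rfl
    rw [leftDiv_piece_mul, if_pos rfl]

end

/-- Left division is a function of the heap, so the quotient is unique. -/
theorem piece_mul_cancel {a : V} {H K : Heap G} (h : piece G a * H = piece G a * K) : H = K := by
  have := leftDiv_eq_some.2 h
  rw [leftDiv_eq_some.2 rfl] at this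
  exact Option.some.inj this

theorem mul_cancel {A H K : Heap G} (h : A * H = A * K) : H = K := by
  induction A using cons_induction with
  | one => simpa using h
  | cons v A ih => exact ih (piece_mul_cancel (by simpa [mul_assoc] using h))

/-! ### Sources -/

/-- The heap `H` has a source at the vertex `a`. -/
def IsSource (a : V) (H : Heap G) : Prop := ∃ K, H = piece G a * K

theorem not_isSource_one (a : V) : ¬ IsSource a (1 : Heap G) := by
  rintro ⟨K, h⟩
  have := congrArg size h
  simp only [size_one, size_mul, size_piece] at this
  omega

theorem exists_isSource {H : Heap G} (h : H ≠ 1) : ∃ a, IsSource a H := by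
  obtain ⟨w, rfl⟩ := exists_ofWord H
  cases w with
  | nil => exact absurd rfl h
  | cons v w => exact ⟨v, ofWord G w, rfl⟩

theorem IsSource.mem_type {a : V} {H : Heap G} (h : IsSource a H) : a ∈ H.type := by
  obtain ⟨K, rfl⟩ := h
  simp

theorem IsSource.mul_right {a : V} {H : Heap G} (h : IsSource a H) (K : Heap G) :
    IsSource a (H * K) := by
  obtain ⟨L, rfl⟩ := h
  exact ⟨L * K, mul_assoc _ _ _⟩

theorem piece_mul_comm_of_indep {a : V} {A : Heap G} (h : ∀ b ∈ A.type, Indep G a b) :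
    piece G a * A = A * piece G a := by
  induction A using cons_induction with
  | one => simp
  | cons v A ih =>
    rw [← mul_assoc, piece_comm (h v (by simp)), mul_assoc, mul_assoc,
      ih fun b hb => h b (by simp [hb])]

theorem isSource_piece_mul {a b : V} {H : Heap G} :
    IsSource a (piece G b * H) ↔ a = b ∨ Indep G a b ∧ IsSource a H := by
  constructor
  · rintro ⟨K, h⟩
    have h' := leftDiv_eq_some.2 h
    rw [leftDiv_piece_mul] at h'
    split_ifs at h' with h1 h2
    · exact Or.inl h1.symm
    · obtain ⟨L, hL, -⟩ := Option.map_eq_some_iff.1 h'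
      exact Or.inr ⟨⟨fun h => h1 h.symm, h2⟩, L, leftDiv_eq_some.1 hL⟩
  · rintro (rfl | ⟨hi, L, rfl⟩)
    · exact ⟨H, rfl⟩
    · exact ⟨piece G b * L, by rw [← mul_assoc, ← mul_assoc, piece_comm hi]⟩

theorem isSource_mul {a : V} {A B : Heap G} :
    IsSource a (A * B) ↔ IsSource a A ∨ (∀ b ∈ A.type, Indep G a b) ∧ IsSource a B := by
  induction A using cons_induction with
  | one => simp [not_isSource_one]
  | cons v A ih =>
    rw [mul_assoc, isSource_piece_mul, ih, isSource_piece_mul]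
    simp only [type_mul, type_piece, Multiset.mem_add, Multiset.mem_singleton, forall_eq_or_imp]
    tauto

/-- The heaps `r` and `s` have independent vertices. -/
def IndepHeaps (r s : Heap G) : Prop := ∀ a ∈ r.type, ∀ b ∈ s.type, Indep G a b

theorem IndepHeaps.symm {r s : Heap G} (h : IndepHeaps r s) : IndepHeaps s r :=
  fun a ha b hb => (h b hb a ha).symm

theorem IndepHeaps.notMem {r s : Heap G} (h : IndepHeaps r s) {a : V} (ha : a ∈ r.type) :
    a ∉ s.type := fun hs => not_indep_self a (h a ha a hs)

/-- Levi's lemma. -/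
theorem levi {A B C D : Heap G} (h : A * B = C * D) : ∃ p r s q : Heap G,
    A = p * r ∧ B = s * q ∧ C = p * s ∧ D = r * q ∧ IndepHeaps r s := by
  induction A using cons_induction generalizing C D with
  | one => exact ⟨1, 1, C, D, by simp, by simpa using h, by simp, by simp, by simp [IndepHeaps]⟩
  | cons a A ih =>
    rw [mul_assoc] at h
    have hs : IsSource a (C * D) := ⟨A * B, h.symm⟩
    rcases isSource_mul.1 hs with ⟨C', rfl⟩ | ⟨hi, D', rfl⟩
    · rw [mul_assoc] at h
      obtain ⟨p, r, s, q, rfl, rfl, rfl, rfl, hrs⟩ := ih (piece_mul_cancel h)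
      exact ⟨piece G a * p, r, s, q, by rw [mul_assoc], rfl, by rw [mul_assoc], rfl, hrs⟩
    -- Here the piece `a` comes from `D` and commutes past all of `C`, so it is added to `r`.
    · rw [← mul_assoc C, ← piece_mul_comm_of_indep hi, mul_assoc] at h
      obtain ⟨p, r, s, q, rfl, rfl, rfl, rfl, hrs⟩ := ih (piece_mul_cancel h)
      refine ⟨p, piece G a * r, s, q, ?_, rfl, rfl, by rw [mul_assoc], ?_⟩
      · rw [← mul_assoc, ← mul_assoc,
          piece_mul_comm_of_indep fun b hb => hi b (by simp [hb])]
      · intro x hx y hy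
        simp only [type_mul, type_piece, Multiset.mem_add, Multiset.mem_singleton] at hx
        rcases hx with rfl | hx
        · exact hi y (by simp [hy])
        · exact hrs x hx y hy

/-- A left factor of a heap is determined by its type. -/
theorem eq_of_mul_eq_mul_of_type_eq {A B C D : Heap G} (h : A * B = C * D)
    (ht : A.type = C.type) : A = C := by
  obtain ⟨p, r, s, q, rfl, rfl, rfl, rfl, hrs⟩ := levi h
  simp only [type_mul, add_right_inj] at ht
  -- Now `r` and `s` have the same type but independent vertices, and no vertex is independent of
  -- itself.
  have hr : r.type = 0 := Multiset.eq_zero_of_forall_notMem fun a ha =>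
    hrs.notMem ha (ht ▸ ha)
  rw [eq_one_of_type_eq_zero hr, eq_one_of_type_eq_zero (H := s) (ht ▸ hr)]

/-! ### Pyramids -/

/-- The heap `H` has a unique source, located at `v`. -/
def IsPyr (v : V) (H : Heap G) : Prop := ∀ a, IsSource a H ↔ a = v

theorem IsPyr.ne_one {v : V} {H : Heap G} (h : IsPyr v H) : H ≠ 1 := by
  rintro rfl
  exact not_isSource_one v ((h v).2 rfl)

theorem IsPyr.mem_type {v : V} {H : Heap G} (h : IsPyr v H) : v ∈ H.type :=
  ((h v).2 rfl).mem_type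

theorem IsPyr.root_unique {u v : V} {H : Heap G} (hu : IsPyr u H) (hv : IsPyr v H) : u = v :=
  (hv u).1 ((hu u).2 rfl)

theorem isPyr_of_forall {v : V} {H : Heap G} (h1 : H ≠ 1) (h : ∀ a, IsSource a H → a = v) :
    IsPyr v H := by
  obtain ⟨b, hb⟩ := exists_isSource h1
  have := h b hb
  subst this
  exact fun a => ⟨h a, by rintro rfl; exact hb⟩

theorem IsPyr.left_factor {v : V} {H K : Heap G} (h : IsPyr v (H * K)) (h1 : H ≠ 1) :
    IsPyr v H :=
  isPyr_of_forall h1 fun a ha => (h a).1 (ha.mul_right K)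

/-- A source contributed by `Y` would have to commute past a piece of `K` at its own vertex. -/
theorem IsPyr.mul {v : V} {K Y : Heap G} (hK : IsPyr v K) (hY : ∀ a ∈ Y.type, a ∈ K.type) :
    IsPyr v (K * Y) := by
  intro a
  rw [isSource_mul, hK a, or_iff_left]
  rintro ⟨h1, h2⟩
  exact not_indep_self a (h1 a (hY a h2.mem_type))

theorem IsPyr.pow {v : V} {K : Heap G} (hK : IsPyr v K) {n : ℕ} (hn : n ≠ 0) : IsPyr v (K ^ n) := by
  obtain ⟨n, rfl⟩ := Nat.exists_eq_succ_of_ne_zero hn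
  rw [pow_succ']
  refine hK.mul fun a ha => ?_
  rw [type_pow] at ha
  exact Multiset.mem_of_mem_nsmul ha

/-- Two left factors of a heap are comparable when the remainders are empty or pyramids with the
same root. -/
theorem levi_pyr {v : V} {A B C D : Heap G} (hB : B = 1 ∨ IsPyr v B) (hD : D = 1 ∨ IsPyr v D)
    (h : A * B = C * D) : (∃ s, C = A * s ∧ B = s * D) ∨ (∃ r, A = C * r ∧ D = r * B) := by
  obtain ⟨p, r, s, q, rfl, rfl, rfl, rfl, hrs⟩ := levi h
  by_cases hr : r = 1
  · subst hr
    exact Or.inl ⟨s, by simp, by simp⟩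
  by_cases hs : s = 1
  · subst hs
    exact Or.inr ⟨r, by simp, by simp⟩
  -- Both `r` and `s` are now nonempty left factors of pyramids with root `v`, so both have a piece
  -- at `v`, against independence.
  have h1 : IsPyr v s := by
    rcases hB with h' | h'
    · exact absurd (mul_eq_one h').1 hs
    · exact h'.left_factor hs
  have h2 : IsPyr v r := by
    rcases hD with h' | h'
    · exact absurd (mul_eq_one h').1 hr
    · exact h'.left_factor hr
  exact absurd h1.mem_type (hrs.notMem h2.mem_type)

open Classical in
/-- The decomposition of a heap at a marked piece is unique. -/
theorem decomp_unique {v : V} {A B C D : Heap G} (hB : IsPyr v B) (hD : IsPyr v D)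
    (h : A * B = C * D) (hc : A.type.count v = C.type.count v) : A = C ∧ B = D := by
  have key : ∀ {A B C D : Heap G}, IsPyr v B → IsPyr v D → A.type.count v = C.type.count v →
      (∃ s, C = A * s ∧ B = s * D) → A = C ∧ B = D := by
    rintro A B C D hB hD hc ⟨s, rfl, rfl⟩
    by_cases hs : s = 1
    · subst hs
      simp
    · have := Multiset.count_pos.2 (hB.left_factor hs).mem_type
      rw [type_mul, Multiset.count_add] at hc
      omega
  rcases levi_pyr (Or.inr hB) (Or.inr hD) h with h | h
  · exact key hB hD hc h
  · have := key hD hB hc.symm h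
    exact ⟨this.1.symm, this.2.symm⟩

/-- Commuting pyramids with the same root are powers of a common heap. -/
theorem exists_common_root {v : V} {K Y : Heap G} (hK : IsPyr v K) (hY : IsPyr v Y)
    (h : K * Y = Y * K) : ∃ (Z : Heap G) (a b : ℕ), K = Z ^ a ∧ Y = Z ^ b := by
  obtain ⟨n, hn⟩ : ∃ n, n = K.size + Y.size := ⟨_, rfl⟩
  induction n using Nat.strong_induction_on generalizing K Y with
  | _ n ih =>
  have key : ∀ {K Y : Heap G}, IsPyr v K → IsPyr v Y → K * Y = Y * K → n = K.size + Y.size →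
      (∃ s, Y = K * s) → ∃ (Z : Heap G) (a b : ℕ), K = Z ^ a ∧ Y = Z ^ b := by
    rintro K Y hK hY h hn ⟨s, rfl⟩
    by_cases hs : s = 1
    · exact ⟨K, 1, 1, by simp, by simp [hs]⟩
    -- Euclid's algorithm on sizes: the quotient `s` of `Y` by `K` again commutes with `K` and is a
    -- pyramid at `v`.
    have hc : K * s = s * K := mul_cancel (by rw [h, mul_assoc])
    have hs' : IsPyr v s := (hc ▸ hY).left_factor hs
    obtain ⟨Z, a, b, h1, h2⟩ := ih (K.size + s.size)
      (by have := size_pos hK.ne_one; rw [hn, size_mul]; omega) hK hs' hc rfl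
    exact ⟨Z, a, a + b, h1, by rw [pow_add, ← h1, ← h2]⟩
  rcases levi_pyr (Or.inr hY) (Or.inr hK) h with ⟨s, hs, -⟩ | ⟨s, hs, -⟩
  · exact key hK hY h hn ⟨s, hs⟩
  · obtain ⟨Z, a, b, h1, h2⟩ := key hY hK h.symm (by omega) ⟨s, hs⟩
    exact ⟨Z, b, a, h2, h1⟩

theorem pow_eq_of_not_isPeriodic {K Z : Heap G} {a : ℕ} (hK : ¬ K.IsPeriodic) (h : K = Z ^ a) :
    a = 1 := by
  by_contra ha
  rcases Nat.lt_or_ge 1 a with h1 | h1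
  · exact hK ⟨Z, a, h1, h.symm⟩
  · have : a = 0 := by omega
    subst this
    -- The empty heap is periodic, being its own square.
    exact hK ⟨1, 2, one_lt_two, by simp [h]⟩

/-- Heaps with equal positive powers commute. -/
theorem commute_of_pow_eq {K L : Heap G} {k l : ℕ} (hk : k ≠ 0) (hl : l ≠ 0)
    (h : K ^ k = L ^ l) : K * L = L * K := by
  obtain ⟨k, rfl⟩ := Nat.exists_eq_succ_of_ne_zero hk
  obtain ⟨l, rfl⟩ := Nat.exists_eq_succ_of_ne_zero hl
  -- Both `K * L` and `L * K` are left factors of the square of the common power, and they have the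
  -- same type.
  refine eq_of_mul_eq_mul_of_type_eq (B := L ^ l * K ^ k) (D := K ^ k * L ^ l) ?_ ?_
  · calc K * L * (L ^ l * K ^ k) = K * L ^ (l + 1) * K ^ k := by simp only [pow_succ', mul_assoc]
      _ = K * K ^ (k + 1) * K ^ k := by rw [← h]
      _ = K ^ (k + 1) * K ^ (k + 1) := by
        rw [← pow_succ', ← pow_add, ← pow_add]; congr 1; omega
      _ = L ^ (l + 1) * L ^ (l + 1) := by rw [h]
      _ = L * L ^ (l + 1) * L ^ l := by
        rw [← pow_succ', ← pow_add, ← pow_add]; congr 1; omega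
      _ = L * K ^ (k + 1) * L ^ l := by rw [h]
      _ = L * K * (K ^ k * L ^ l) := by simp only [pow_succ', mul_assoc]
  · rw [type_mul, type_mul, add_comm]

/-- Equal powers make `K` and `L` commute, hence powers of one heap; aperiodicity forces both
exponents to be 1. -/
theorem root_unique {v : V} {K L : Heap G} {k l : ℕ} (hKp : IsPyr v K) (hLp : IsPyr v L)
    (hK : ¬ K.IsPeriodic) (hL : ¬ L.IsPeriodic) (hk : k ≠ 0) (hl : l ≠ 0) (h : K ^ k = L ^ l) :
    K = L := by
  obtain ⟨Z, a, b, h1, h2⟩ := exists_common_root hKp hLp (commute_of_pow_eq hk hl h)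
  rw [h1, h2, pow_eq_of_not_isPeriodic hK h1, pow_eq_of_not_isPeriodic hL h2]

theorem exists_aperiodic_root {v : V} {P : Heap G} (hP : IsPyr v P) :
    ∃ (K : Heap G) (k : ℕ), k ≠ 0 ∧ IsPyr v K ∧ ¬ K.IsPeriodic ∧ K ^ k = P := by
  obtain ⟨n, hn⟩ : ∃ n, n = P.size := ⟨_, rfl⟩
  induction n using Nat.strong_induction_on generalizing P with
  | _ n ih =>
  by_cases h : P.IsPeriodic
  · obtain ⟨Q, q, hq, rfl⟩ := h
    have hQ1 : Q ≠ 1 := by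
      rintro rfl
      exact hP.ne_one (one_pow q)
    have hQ : IsPyr v Q := by
      obtain ⟨q, rfl⟩ : ∃ q', q = q' + 1 := ⟨q - 1, by omega⟩
      rw [pow_succ'] at hP
      exact hP.left_factor hQ1
    have := size_pos hQ1
    obtain ⟨K, k, hk, h1, h2, h3⟩ := ih Q.size (by rw [hn, size_pow]; nlinarith) hQ rfl
    exact ⟨K, k * q, Nat.mul_ne_zero hk (by omega), h1, h2, by rw [pow_mul, h3]⟩
  · exact ⟨P, 1, one_ne_zero, hP, h, pow_one P⟩

end Heap

end Trace

end Kromatic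

/-! ### Conjugacy of heaps, and rotations as conjugate pyramids -/

namespace Kromatic

section Trace

variable {V : Type*} {G : SimpleGraph V}

namespace Heap

/-! ### Conjugation of heaps -/

/-- The vertices in `t` induce a connected graph. -/
def ConnType (G : SimpleGraph V) (t : Multiset V) : Prop :=
  ∀ S : Set V, (∀ a ∈ t, ∀ b ∈ t, a ∈ S → b ∉ S → Indep G a b) →
    (∀ a ∈ t, a ∈ S) ∨ (∀ a ∈ t, a ∉ S)

open Classical in
theorem ofWord_eq_filter_mul (S : Set V) (w : List V)
    (h : ∀ a ∈ w, ∀ b ∈ w, a ∈ S → b ∉ S → Indep G a b) :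
    ofWord G w = ofWord G (w.filter (· ∈ S)) * ofWord G (w.filter (· ∉ S)) := by
  induction w with
  | nil => simp
  | cons v w ih =>
    have ih' := ih fun a ha b hb => h a (by simp [ha]) b (by simp [hb])
    by_cases hv : v ∈ S
    · simp only [List.filter_cons, hv, not_true_eq_false, decide_true, decide_false, if_true,
        ofWord_cons, Bool.false_eq_true, if_false]
      rw [ih', mul_assoc]
    · simp only [List.filter_cons, hv, not_false_eq_true, decide_true, decide_false, if_true,
        ofWord_cons, Bool.false_eq_true, if_false]
      rw [ih', ← mul_assoc, ← mul_assoc, piece_mul_comm_of_indep]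
      intro b hb
      rw [type_ofWord, Multiset.mem_coe, List.mem_filter] at hb
      exact (h b (by simp [hb.1]) v (by simp) (by simpa using hb.2) hv).symm

/-- If the vertices split into two mutually independent parts, the heap is a product of two
commuting nonempty factors, each of which contributes a source. -/
theorem IsPyr.connType {v : V} {H : Heap G} (h : IsPyr v H) : ConnType G H.type := by
  classical
  intro S hS
  obtain ⟨w, rfl⟩ := exists_ofWord H
  simp only [type_ofWord, Multiset.mem_coe] at hS ⊢
  by_contra hcon
  push Not at hcon
  obtain ⟨⟨b, hb, hbS⟩, a, ha, haS⟩ := hcon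
  have hsplit := ofWord_eq_filter_mul S w hS
  have hA : ofWord G (w.filter (· ∈ S)) ≠ 1 := by
    intro h1
    have := congrArg type h1
    rw [type_ofWord, type_one, Multiset.coe_eq_zero, List.filter_eq_nil_iff] at this
    exact this a ha (by simpa using haS)
  have hB : ofWord G (w.filter (· ∉ S)) ≠ 1 := by
    intro h1
    have := congrArg type h1
    rw [type_ofWord, type_one, Multiset.coe_eq_zero, List.filter_eq_nil_iff] at this
    exact this b hb (by simpa using hbS)
  obtain ⟨x, hx⟩ := exists_isSource hA
  obtain ⟨y, hy⟩ := exists_isSource hB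
  have hx' := hx.mem_type
  have hy' := hy.mem_type
  simp only [type_ofWord, Multiset.mem_coe, List.mem_filter, decide_eq_true_eq] at hx' hy'
  rw [hsplit] at h
  have h1 : x = v := (h x).1 (isSource_mul.2 (Or.inl hx))
  have h2 : y = v := (h y).1 (isSource_mul.2 (Or.inr ⟨fun c hc => by
    simp only [type_ofWord, Multiset.mem_coe, List.mem_filter, decide_eq_true_eq] at hc
    exact (hS c hc.1 y hy'.1 hc.2 hy'.2).symm, hy⟩))
  exact hy'.2 (by rw [h2, ← h1]; exact hx'.2)

theorem ConnType.eq_one_of_indep {U W : Heap G} (h : ConnType G (U * W).type) (hW : W ≠ 1)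
    (hi : IndepHeaps U W) : U = 1 := by
  rcases h {a | a ∈ U.type} (fun a ha b hb haU hbU => by
    rw [type_mul, Multiset.mem_add] at hb
    exact hi a haU b (hb.resolve_left hbU)) with h' | h'
  · obtain ⟨a, ha⟩ := exists_isSource hW
    have := h' a (by rw [type_mul, Multiset.mem_add]; exact Or.inr ha.mem_type)
    exact absurd ha.mem_type (hi.notMem this)
  · by_contra hU
    obtain ⟨a, ha⟩ := exists_isSource hU
    exact h' a (by rw [type_mul, Multiset.mem_add]; exact Or.inl ha.mem_type) ha.mem_type

/-- Conjugacy of heaps by a left factor of a power. -/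
def IsConjugate (H K : Heap G) : Prop := ∃ (X Y : Heap G) (N : ℕ), X * Y = H ^ N ∧ H * X = X * K

theorem pow_mul_eq {H K X : Heap G} (h : H * X = X * K) (n : ℕ) : H ^ n * X = X * K ^ n :=
  (SemiconjBy.pow_right (show SemiconjBy X K H from h.symm) n).eq.symm

theorem type_eq_of_mul_eq {H K X : Heap G} (h : H * X = X * K) : H.type = K.type := by
  have := congrArg type h
  rw [type_mul, type_mul, add_comm] at this
  exact add_left_cancel this

theorem IsConjugate.type_eq {H K : Heap G} (h : IsConjugate H K) : H.type = K.type := by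
  obtain ⟨X, Y, N, -, h⟩ := h
  exact type_eq_of_mul_eq h

theorem IsConjugate.refl (H : Heap G) : IsConjugate H H := ⟨1, 1, 0, by simp, by simp⟩

/-- This is why `X` is required to be a left factor of a power: its complement `Y` satisfies `Y * X
= K ^ N` and conjugates back. -/
theorem IsConjugate.symm {H K : Heap G} (h : IsConjugate H K) : IsConjugate K H := by
  obtain ⟨X, Y, N, h1, h2⟩ := h
  refine ⟨Y, X, N, ?_, ?_⟩
  · refine mul_cancel (A := X) ?_
    rw [← mul_assoc, h1, pow_mul_eq h2]
  · refine mul_cancel (A := X) ?_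
    rw [← mul_assoc, ← h2, mul_assoc, h1, ← mul_assoc, h1, ← pow_succ, ← pow_succ']

theorem IsConjugate.trans {H K L : Heap G} (h : IsConjugate H K) (h' : IsConjugate K L) : IsConjugate H L := by
  obtain ⟨X, Y, N, h1, h2⟩ := h
  obtain ⟨X', Y', N', h3, h4⟩ := h'
  refine ⟨X * X', Y' * Y, N' + N, ?_, ?_⟩
  · calc X * X' * (Y' * Y) = X * (X' * Y') * Y := by simp only [mul_assoc]
      _ = H ^ N' * (X * Y) := by rw [h3, ← pow_mul_eq h2, mul_assoc]
      _ = H ^ (N' + N) := by rw [h1, pow_add]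
  · rw [← mul_assoc, h2, mul_assoc, h4, mul_assoc]

/-- With `H = Z ^ a`, both `X` and `Z * X` are left factors of one power of `Z`. Levi's lemma and a
comparison of types give `Z * X = X * s`, and then `s ^ a = K` by cancelling `X`. -/
theorem IsConjugate.isPeriodic {H K : Heap G} (h : IsConjugate H K) (hH : H.IsPeriodic) : K.IsPeriodic := by
  obtain ⟨X, Y, N, h1, h2⟩ := h
  obtain ⟨Z, a, ha, rfl⟩ := hH
  have h3 : X * (Y * Z) = Z * X * Y := by
    rw [← mul_assoc, h1, mul_assoc, h1, ← pow_mul, ← pow_succ, ← pow_succ']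
  obtain ⟨p, r, s, q, h4, -, h6, -, hrs⟩ := levi h3
  have hr : r.type = 0 := by
    refine Multiset.eq_zero_of_forall_notMem fun x hx => hrs.notMem hx ?_
    have := congrArg type h6
    rw [h4] at this
    simp only [type_mul] at this
    have h7 : s.type = Z.type + r.type := by
      apply add_left_cancel (a := p.type)
      rw [← this]
      abel
    rw [h7]
    simp [hx]
  have hr1 := eq_one_of_type_eq_zero hr
  subst hr1
  rw [mul_one] at h4
  subst h4
  refine ⟨s, a, ha, ?_⟩
  refine mul_cancel (A := X) ?_
  rw [← h2, pow_mul_eq h6]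

/-! ### Rotations -/

open Classical in
/-- `K` is the rotation of `H` at the piece at the vertex `v` that follows `c` others there. -/
def IsRot (H : Heap G) (v : V) (c : ℕ) (K : Heap G) : Prop :=
  ∃ (X Y : Heap G) (N : ℕ), X * Y = H ^ N ∧ H * X = X * K ∧ X.type.count v = c ∧ IsPyr v K

theorem IsRot.isConj {H K : Heap G} {v : V} {c : ℕ} (h : IsRot H v c K) : IsConjugate H K := by
  obtain ⟨X, Y, N, h1, h2, -⟩ := h
  exact ⟨X, Y, N, h1, h2⟩

theorem IsRot.isPyr {H K : Heap G} {v : V} {c : ℕ} (h : IsRot H v c K) : IsPyr v K := by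
  obtain ⟨X, Y, N, -, -, -, h⟩ := h
  exact h

theorem mem_type_of_mul_eq_pow {X Y H : Heap G} {N : ℕ} (h : X * Y = H ^ N) {a : V}
    (ha : a ∈ X.type ∨ a ∈ Y.type) : a ∈ H.type := by
  have : a ∈ (X * Y).type := by rwa [type_mul, Multiset.mem_add]
  rw [h, type_pow] at this
  exact Multiset.mem_of_mem_nsmul this

/-- In a higher power of `H` the remainder `K ^ (M - N) * Y` is a pyramid at `v`. Two conjugators
can thus be compared inside a common power by `decomp_unique` or `levi_pyr`. -/
theorem exists_remainder {v : V} {H K X Y : Heap G} {N M : ℕ} (h1 : X * Y = H ^ N)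
    (h2 : H * X = X * K) (hK : IsPyr v K) (hM : N < M) : ∃ B, IsPyr v B ∧ X * B = H ^ M := by
  refine ⟨K ^ (M - N) * Y, ?_, ?_⟩
  · refine (hK.pow (by omega)).mul fun a ha => ?_
    rw [type_pow, Multiset.mem_nsmul_of_ne_zero (by omega), ← type_eq_of_mul_eq h2]
    exact mem_type_of_mul_eq_pow h1 (Or.inr ha)
  · rw [← mul_assoc, ← pow_mul_eq h2, mul_assoc, h1, ← pow_add]
    congr 1
    omega

theorem IsRot.unique {H K K' : Heap G} {v : V} {c : ℕ} (h : IsRot H v c K)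
    (h' : IsRot H v c K') : K = K' := by
  obtain ⟨X, Y, N, h1, h2, h3, h4⟩ := h
  obtain ⟨X', Y', N', h1', h2', h3', h4'⟩ := h'
  obtain ⟨B, hB, hXB⟩ := exists_remainder (M := N + N' + 1) h1 h2 h4 (by omega)
  obtain ⟨B', hB', hXB'⟩ := exists_remainder (M := N + N' + 1) h1' h2' h4' (by omega)
  obtain ⟨rfl, -⟩ := decomp_unique hB hB' (hXB.trans hXB'.symm) (h3.trans h3'.symm)
  exact mul_cancel (h2.symm.trans h2')

open Classical in
/-- Different pieces of an aperiodic heap give different rotations. -/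
theorem IsRot.not_lt {H K : Heap G} {v : V} {c c' : ℕ} (h : IsRot H v c K)
    (h' : IsRot H v c' K) (hK : ¬ K.IsPeriodic) (hc : c' < H.type.count v) : ¬ c < c' := by
  intro hlt
  obtain ⟨X, Y, N, h1, h2, h3, h4⟩ := h
  obtain ⟨X', Y', N', h1', h2', h3', -⟩ := h'
  obtain ⟨B, hB, hXB⟩ := exists_remainder (M := N + N' + 1) h1 h2 h4 (by omega)
  obtain ⟨B', hB', hXB'⟩ := exists_remainder (M := N + N' + 1) h1' h2' h4 (by omega)
  rcases levi_pyr (Or.inr hB) (Or.inr hB') (hXB.trans hXB'.symm) with ⟨s, rfl, rfl⟩ | ⟨r, rfl, -⟩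
  · have hs1 : s ≠ 1 := by
      rintro rfl
      rw [mul_one] at h3'
      omega
    have hs := hB.left_factor hs1
    -- Two conjugators to the same `K` differ by a heap `s` commuting with `K`. As `K` is aperiodic,
    -- `s` is a positive power of it and has at least as many pieces at `v` as `H`, too many for
    -- `c'`.
    have hcomm : K * s = s * K := by
      refine mul_cancel (A := X) ?_
      rw [← mul_assoc, ← h2, mul_assoc, h2', mul_assoc]
    obtain ⟨Z, a, b, hKZ, hsZ⟩ := exists_common_root h4 hs hcomm
    have ha := pow_eq_of_not_isPeriodic hK hKZ
    subst ha
    rw [pow_one] at hKZ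
    subst hKZ
    rw [type_mul, Multiset.count_add, h3, hsZ, type_pow, Multiset.count_nsmul,
      ← type_eq_of_mul_eq h2] at h3'
    have hb : b ≠ 0 := by
      rintro rfl
      exact hs1 (by rw [hsZ, pow_zero])
    have : H.type.count v ≤ b * H.type.count v := Nat.le_mul_of_pos_left _ (Nat.pos_of_ne_zero hb)
    omega
  · rw [type_mul, Multiset.count_add] at h3
    omega

open Classical in
-- A conjugator with at least as many pieces at `v` as `H` has `H` as a left factor; dividing it out
-- lowers `N` and keeps `K`.
theorem IsConjugate.exists_isRot {H K : Heap G} {v : V} (h : IsConjugate H K) (hK : IsPyr v K) :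
    ∃ c < H.type.count v, IsRot H v c K := by
  have hv : 0 < H.type.count v := by
    rw [Multiset.count_pos, h.type_eq]
    exact hK.mem_type
  obtain ⟨X, Y, N, h1, h2⟩ := h
  induction N generalizing X with
  | zero =>
    have hX : X = 1 := (mul_eq_one (by rw [h1, pow_zero])).1
    subst hX
    exact ⟨0, hv, 1, Y, 0, h1, h2, by simp, hK⟩
  | succ N ih =>
    by_cases hc : X.type.count v < H.type.count v
    · exact ⟨_, hc, X, Y, N + 1, h1, h2, rfl, hK⟩
    obtain ⟨B, hB, hXB⟩ := exists_remainder h1 h2 hK (Nat.lt_succ_self _)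
    rw [pow_succ'] at hXB
    obtain ⟨p, r, s, q, hp, -, hX, rfl, hrs⟩ := levi hXB.symm
    by_cases hr : r = 1
    · subst hr
      rw [mul_one] at hp
      subst hp hX
      refine ih s ?_ ?_
      · refine mul_cancel (A := H) ?_
        rw [← mul_assoc, h1, pow_succ']
      · refine mul_cancel (A := H) ?_
        rw [h2, mul_assoc]
    · have hvr := (hB.left_factor hr).mem_type
      have h3 := Multiset.count_eq_zero.2 (hrs.notMem hvr)
      have h4 := Multiset.count_pos.2 hvr
      rw [hp, hX, type_mul, type_mul, Multiset.count_add, Multiset.count_add] at hc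
      omega

/-- Termination of the rotation process. Decomposing `W * U` again at its first piece at `v` leaves
a left factor `s` of `U`. It is proper: otherwise `U` and `W` would be independent, against
connectedness. The conjugator is the product of the successive `U`. -/
theorem exists_conj_of_notMem {v : V} {U W : Heap G} (hW : IsPyr v W) (hv : v ∉ U.type)
    (hconn : ConnType G (U * W).type)
    (hdec : ∀ H : Heap G, v ∈ H.type → ∃ U W, H = U * W ∧ IsPyr v W ∧ v ∉ U.type) :
    ∃ X Y N K, X * Y = (U * W) ^ N ∧ (U * W) * X = X * K ∧ v ∉ X.type ∧ IsPyr v K := by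
  obtain ⟨n, hn⟩ : ∃ n, n = U.size := ⟨_, rfl⟩
  induction n using Nat.strong_induction_on generalizing U W with
  | _ n ih =>
  by_cases hU1 : U = 1
  · subst hU1
    exact ⟨1, 1, 0, W, by simp, by simp, by simp, hW⟩
  obtain ⟨U', W', h', hW', hv'⟩ := hdec (W * U) (by simp [hW.mem_type])
  obtain ⟨p, r, s, q, rfl, rfl, rfl, rfl, hrs⟩ := levi h'
  have hp : p = 1 := by
    by_contra hp
    exact hv' (by simp [(hW.left_factor hp).mem_type])
  subst hp
  simp only [one_mul] at *
  have hq : q ≠ 1 := by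
    rintro rfl
    rw [mul_one] at hconn hU1
    exact hU1 (hconn.eq_one_of_indep hW.ne_one hrs.symm)
  have hq' := size_pos hq
  obtain ⟨X, Y, N, K, h1, h2, h3, h4⟩ := ih s.size (by rw [hn, size_mul]; omega) hW' hv'
    (by rw [← h', type_mul, add_comm, ← type_mul]; exact hconn) rfl
  rw [← h'] at h1 h2
  refine ⟨s * q * X, Y * r, N + 1, K, ?_, ?_, ?_, h4⟩
  · calc s * q * X * (Y * r) = s * q * (X * Y) * r := by simp only [mul_assoc]
      _ = (s * q * r) ^ N * (s * q * r) := by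
        rw [h1, ← pow_mul_eq (H := s * q * r) (X := s * q) (by simp only [mul_assoc])]
        simp only [mul_assoc]
      _ = (s * q * r) ^ (N + 1) := by rw [pow_succ]
  · calc s * q * r * (s * q * X) = s * q * (r * (s * q) * X) := by simp only [mul_assoc]
      _ = s * q * X * K := by rw [h2, ← mul_assoc]
  · rw [type_mul, Multiset.mem_add]
    exact not_or.2 ⟨hv, h3⟩

end Heap

/-! ### Words -/

open Heap

theorem subword_cons (a : V) (w : List V) (S : Set (Fin (a :: w).length)) [Decidable
    ((0 : Fin (w.length + 1)) ∈ S)] :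
    subword (a :: w) S = if (0 : Fin (w.length + 1)) ∈ S then
      a :: subword w {i | Fin.succ i ∈ S} else subword w {i | Fin.succ i ∈ S} := by
  classical
  have h : subword (a :: w) S = ((List.finRange (w.length + 1)).filter (fun i => i ∈ S)).map
    (a :: w).get := by
    unfold subword
    congr
  rw [h, List.finRange_succ, List.filter_cons, List.filter_map, subword]
  have h2 : (fun i : Fin w.length => (a :: w).get i.succ) = w.get := rfl
  by_cases h0 : (0 : Fin (w.length + 1)) ∈ S
  · simp only [h0, decide_true, if_true, List.map_cons, List.map_map]
    rfl
  · simp only [h0, decide_false, if_false, List.map_map, Bool.false_eq_true]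
    rfl

theorem mem_subword {w : List V} {S : Set (Fin w.length)} {a : V} :
    a ∈ subword w S ↔ ∃ i ∈ S, w.get i = a := by
  classical
  unfold subword
  simp

theorem subword_univ (w : List V) : subword w Set.univ = w := by
  unfold subword
  simp

/-- A piece of `S` has no arrow to a later piece outside `S`, so the two commute and `S` can be
moved to the end. -/
theorem ofWord_eq_subword_mul (w : List V) (S : Set (Fin w.length))
    (hS : ∀ i ∈ S, ∀ j, Arrow G w i j → j ∈ S) :
    ofWord G w = ofWord G (subword w Sᶜ) * ofWord G (subword w S) := by
  classical
  induction w with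
  | nil => rfl
  | cons a w ih =>
    have ih' := ih {i | Fin.succ i ∈ S} fun i hi j hij =>
      hS i.succ hi j.succ ⟨Fin.succ_lt_succ_iff.2 hij.1, hij.2⟩
    have hc : {i : Fin w.length | Fin.succ i ∈ Sᶜ} = {i : Fin w.length | Fin.succ i ∈ S}ᶜ := rfl
    by_cases h0 : (0 : Fin (w.length + 1)) ∈ S
    · have h0' : (0 : Fin (w.length + 1)) ∉ Sᶜ := fun h => h h0
      rw [subword_cons, subword_cons, if_neg h0', if_pos h0, hc, ofWord_cons, ih', ofWord_cons,
        ← mul_assoc, ← mul_assoc, piece_mul_comm_of_indep]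
      intro b hb
      rw [type_ofWord, Multiset.mem_coe, mem_subword] at hb
      obtain ⟨i, hi, rfl⟩ := hb
      have h1 : ¬ Arrow G (a :: w) (0 : Fin (w.length + 1)) i.succ := fun h => hi (hS _ h0 _ h)
      have h2 : (0 : Fin (w.length + 1)) < i.succ := Fin.succ_pos i
      exact ⟨fun h => h1 ⟨h2, Or.inl h⟩, fun h => h1 ⟨h2, Or.inr h⟩⟩
    · have h0' : (0 : Fin (w.length + 1)) ∈ Sᶜ := h0
      rw [subword_cons, subword_cons, if_pos h0', if_neg h0, hc, ofWord_cons, ih', ofWord_cons,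
        mul_assoc]

theorem exists_of_isSource_subword {w : List V} {S : Set (Fin w.length)} {a : V}
    (h : IsSource a (ofWord G (subword w S))) :
    ∃ i ∈ S, w.get i = a ∧ ∀ j ∈ S, ¬ Arrow G w j i := by
  classical
  induction w with
  | nil => exact absurd h (not_isSource_one a)
  | cons b w ih =>
    have key : IsSource a (ofWord G (subword w {i | Fin.succ i ∈ S})) →
        ((0 : Fin (w.length + 1)) ∈ S → Indep G a b) →
        ∃ i ∈ S, (b :: w).get i = a ∧ ∀ j ∈ S, ¬ Arrow G (b :: w) j i := by
      intro hs hi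
      obtain ⟨i, hiS, hia, hj⟩ := ih hs
      refine ⟨i.succ, hiS, hia, fun j hjS hji => ?_⟩
      induction j using Fin.cases with
      | zero =>
        have h1 := (hi hjS).symm
        rcases hji.2 with h2 | h2
        · exact h1.1 (h2.trans hia)
        · refine h1.2 ?_
          rw [← hia]
          exact h2
      | succ j => exact hj j hjS ⟨Fin.succ_lt_succ_iff.1 hji.1, hji.2⟩
    rw [subword_cons] at h
    split_ifs at h with h0
    · rw [ofWord_cons, isSource_piece_mul] at h
      rcases h with rfl | ⟨hi, hs⟩
      · exact ⟨(0 : Fin (w.length + 1)), h0, rfl, fun j _ hj => absurd hj.1 (Fin.not_lt_zero j)⟩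
      · exact key hs fun _ => hi
    · exact key h fun h' => absurd h' h0

theorem isSource_get {w : List V} {i : Fin w.length} (h : ∀ j, ¬ Arrow G w j i) :
    IsSource (w.get i) (ofWord G w) := by
  induction w with
  | nil => exact i.elim0
  | cons b w ih =>
    rw [ofWord_cons, isSource_piece_mul]
    induction i using Fin.cases with
    | zero => exact Or.inl rfl
    | succ i =>
      have h1 := h (0 : Fin (w.length + 1))
      have h2 : (0 : Fin (w.length + 1)) < i.succ := Fin.succ_pos i
      refine Or.inr ⟨Indep.symm ⟨fun h => h1 ⟨h2, Or.inl h⟩, fun h => h1 ⟨h2, Or.inr h⟩⟩,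
        ih fun j hj => h j.succ ⟨Fin.succ_lt_succ_iff.2 hj.1, hj.2⟩⟩

theorem eq_of_sources {w : List V} {i j : Fin w.length} (hi : ∀ k, ¬ Arrow G w k i)
    (hj : ∀ k, ¬ Arrow G w k j) (h : w.get i = w.get j) : i = j := by
  rcases lt_trichotomy i j with h' | h' | h'
  · exact absurd ⟨h', Or.inl h⟩ (hj i)
  · exact h'
  · exact absurd ⟨h', Or.inl h.symm⟩ (hi j)

/-- Sources as positions in a word correspond to sources as vertices, since two positions with the
same letter are joined by an arrow and cannot both be sources. -/
theorem Heap.isPyramid_iff {H : Heap G} : H.IsPyramid ↔ ∃ v, IsPyr v H := by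
  have hsrc : ∀ (w : List V) (a : V), IsSource a (ofWord G w) →
      ∃ i, w.get i = a ∧ ∀ j, ¬ Arrow G w j i := by
    intro w a h
    rw [← subword_univ w] at h
    have h' := exists_of_isSource_subword (w := w) (S := Set.univ) h
    obtain ⟨i, -, h1, h2⟩ := h'
    exact ⟨i, h1, fun j => h2 j trivial⟩
  constructor
  · rintro ⟨w, rfl, i, hi, huniq⟩
    refine ⟨w.get i, fun a => ⟨fun ha => ?_, ?_⟩⟩
    · obtain ⟨j, rfl, hj⟩ := hsrc w a ha
      rw [huniq j hj]
    · rintro rfl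
      exact isSource_get hi
  · rintro ⟨v, hv⟩
    obtain ⟨w, rfl⟩ := exists_ofWord H
    obtain ⟨i, hiv, hi⟩ := hsrc w v ((hv v).2 rfl)
    refine ⟨w, rfl, i, hi, fun j hj => eq_of_sources hj hi ?_⟩
    rw [hiv]
    exact (hv _).1 (isSource_get hj)

theorem isPyr_reach (w : List V) (p : Fin w.length) :
    IsPyr (w.get p) (ofWord G (subword w (reach G w p))) := by
  refine isPyr_of_forall ?_ ?_
  · intro h
    have h1 := congrArg size h
    have h2 := subword_reach_length_pos G w p
    rw [size, type_ofWord, Multiset.coe_card, size_one] at h1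
    omega
  · intro a ha
    obtain ⟨i, hi, rfl, hj⟩ := exists_of_isSource_subword ha
    rcases Relation.ReflTransGen.cases_tail hi with h | ⟨k, hk, hki⟩
    · rw [h]
    · exact absurd hki (hj k hk)

theorem le_of_mem_reach {w : List V} {p i : Fin w.length} (h : i ∈ reach G w p) : p ≤ i := by
  change Relation.ReflTransGen _ _ _ at h
  induction h with
  | refl => exact le_rfl
  | tail _ h ih => exact ih.trans h.1.le

open Classical in
theorem count_subword (v : V) (w : List V) (n : ℕ) (S : Set (Fin w.length))
    (h : ∀ i, w.get i = v → (i ∈ S ↔ i.val < n)) :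
    (subword w S).count v = (w.take n).count v := by
  induction w generalizing n with
  | nil => simp [subword]
  | cons b w ih =>
    cases n with
    | zero =>
      rw [List.take_zero, List.count_nil, List.count_eq_zero, mem_subword]
      rintro ⟨i, hi, hiv⟩
      exact absurd ((h i hiv).1 hi) (Nat.not_lt_zero _)
    | succ n =>
      have ih' := ih n {i | Fin.succ i ∈ S} fun i hi => by
        rw [Set.mem_ofPred_eq, h i.succ hi]
        simp
      rw [subword_cons, List.take_succ_cons, List.count_cons]
      by_cases hb : b = v
      · have h0 : (0 : Fin (w.length + 1)) ∈ S := (h (0 : Fin (w.length + 1)) hb).2 (by simp)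
        rw [if_pos h0, List.count_cons, ih']
      · split_ifs <;> simp_all

open Classical in
-- Of the pieces at the vertex of `p`, the later ones are reachable from `p` and the earlier ones
-- are not. A piece is thereby encoded, independently of the word, by its vertex and the number of
-- earlier pieces there.
theorem count_subword_compl_reach (w : List V) (p : Fin w.length) :
    (subword w (reach G w p)ᶜ).count (w.get p) = (w.take p).count (w.get p) := by
  refine count_subword _ _ _ _ fun i hi => ?_
  rw [Set.mem_compl_iff]
  constructor
  · intro h
    by_contra h'
    rcases (not_lt.1 h').eq_or_lt with h2 | h2
    · exact h (by rw [← Fin.ext h2]; exact Relation.ReflTransGen.refl)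
    · exact h (Relation.ReflTransGen.single ⟨h2, Or.inl hi.symm⟩)
  · intro h h'
    exact absurd (Fin.le_def.1 (le_of_mem_reach h')) (by omega)

theorem ofWord_eq_compl_reach_mul (w : List V) (p : Fin w.length) :
    ofWord G w = ofWord G (subword w (reach G w p)ᶜ) * ofWord G (subword w (reach G w p)) :=
  ofWord_eq_subword_mul w _ fun _ hi _ hij => Relation.ReflTransGen.tail hi hij

open Classical in
theorem exists_take_count {w : List V} {v : V} {c : ℕ} (h : c < w.count v) :
    ∃ p : Fin w.length, w.get p = v ∧ (w.take p).count v = c := by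
  induction w generalizing c with
  | nil => simp at h
  | cons b w ih =>
    by_cases hb : b = v
    · subst hb
      cases c with
      | zero => exact ⟨(0 : Fin (w.length + 1)), rfl, by simp⟩
      | succ c =>
        rw [List.count_cons_self] at h
        obtain ⟨p, h1, h2⟩ := ih (Nat.lt_of_succ_lt_succ h)
        exact ⟨p.succ, h1, by simp [h2]⟩
    · rw [List.count_cons_of_ne hb] at h
      obtain ⟨p, h1, h2⟩ := ih h
      exact ⟨p.succ, h1, by simp [h2, hb]⟩

open Classical in
/-- Every heap can be decomposed at each of its pieces. -/
theorem Heap.exists_decomp {H : Heap G} {v : V} {c : ℕ} (h : c < H.type.count v) :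
    ∃ U W, H = U * W ∧ IsPyr v W ∧ U.type.count v = c := by
  obtain ⟨w, rfl⟩ := exists_ofWord H
  rw [type_ofWord, Multiset.coe_count] at h
  obtain ⟨p, rfl, hp⟩ := exists_take_count h
  refine ⟨_, _, ofWord_eq_compl_reach_mul w p, isPyr_reach w p, ?_⟩
  rw [type_ofWord, Multiset.coe_count, count_subword_compl_reach, hp]

open Classical in
-- After one step from `U * W` to `W * U` the marked piece is the first one at `v`, and
-- `exists_conj_of_notMem` applies.
theorem Heap.exists_isRot {H : Heap G} (hH : ConnType G H.type) {v : V} {c : ℕ}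
    (h : c < H.type.count v) : ∃ K, IsRot H v c K := by
  have hdec : ∀ H : Heap G, v ∈ H.type → ∃ U W, H = U * W ∧ IsPyr v W ∧ v ∉ U.type := by
    intro H hv
    obtain ⟨U, W, h1, h2, h3⟩ := exists_decomp (Multiset.count_pos.2 hv)
    exact ⟨U, W, h1, h2, Multiset.count_eq_zero.1 h3⟩
  obtain ⟨U, W, rfl, hW, hc⟩ := exists_decomp h
  obtain ⟨U', W', h', hW', hv'⟩ := hdec (W * U) (by simp [hW.mem_type])
  obtain ⟨X, Y, N, K, h1, h2, h3, h4⟩ := exists_conj_of_notMem hW' hv'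
    (by rw [← h', type_mul, add_comm, ← type_mul]; exact hH) hdec
  rw [← h'] at h1 h2
  refine ⟨K, U * X, Y * W, N + 1, ?_, ?_, ?_, h4⟩
  · calc U * X * (Y * W) = U * (X * Y) * W := by simp only [mul_assoc]
      _ = (U * W) ^ N * (U * W) := by
        rw [h1, ← pow_mul_eq (H := U * W) (X := U) (by simp only [mul_assoc]), mul_assoc]
      _ = (U * W) ^ (N + 1) := by rw [pow_succ]
  · calc U * W * (U * X) = U * (W * U * X) := by simp only [mul_assoc]
      _ = U * X * K := by rw [h2, ← mul_assoc]
  · rw [type_mul, Multiset.count_add, hc, Multiset.count_eq_zero.2 h3, add_zero]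

/-! ### The rotation process on words -/

open Classical in
theorem rotateStep_spec (x : Σ w : List V, Fin w.length) : ∃ U W : Heap G,
    ofWord G x.1 = U * W ∧ ofWord G (rotateStep G x).1 = W * U ∧ IsPyr (x.1.get x.2) W ∧
    U.type.count (x.1.get x.2) = (x.1.take x.2).count (x.1.get x.2) := by
  refine ⟨_, _, ofWord_eq_compl_reach_mul x.1 x.2, rfl, isPyr_reach x.1 x.2, ?_⟩
  rw [type_ofWord, Multiset.coe_count, count_subword_compl_reach]

theorem rotateStep_get (x : Σ w : List V, Fin w.length) :
    (rotateStep G x).1.get (rotateStep G x).2 = x.1.get x.2 := by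
  have key : ∀ (l l' : List V) (h : 0 < (l ++ l').length), 0 < l.length →
      IsSource ((l ++ l').get ⟨0, h⟩) (ofWord G l) := by
    intro l l' h hl
    cases l with
    | nil => simp at hl
    | cons b l => exact ⟨ofWord G l, rfl⟩
  exact (isPyr_reach (G := G) x.1 x.2 _).1 (key _ _ _ (subword_reach_length_pos G x.1 x.2))

theorem rotateStep_snd (x : Σ w : List V, Fin w.length) : (rotateStep G x).2.val = 0 := rfl

theorem rotateStep_spec_zero (x : Σ w : List V, Fin w.length) (h0 : x.2.val = 0) :
    ∃ U W : Heap G, ofWord G x.1 = U * W ∧ ofWord G (rotateStep G x).1 = W * U ∧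
      IsPyr (x.1.get x.2) W ∧ x.1.get x.2 ∉ U.type := by
  classical
  obtain ⟨U, W, h1, h2, h3, h4⟩ := rotateStep_spec (G := G) x
  exact ⟨U, W, h1, h2, h3, by rw [← Multiset.count_eq_zero, h4, h0]; simp⟩

theorem iterate_rotateStep_of_isPyr (x : Σ w : List V, Fin w.length) (h0 : x.2.val = 0)
    (h : IsPyr (x.1.get x.2) (ofWord G x.1)) (n : ℕ) :
    ofWord G ((rotateStep G)^[n] x).1 = ofWord G x.1 := by
  induction n generalizing x with
  | zero => rfl
  | succ n ih =>
    obtain ⟨U, W, h1, h2, h3, h4⟩ := rotateStep_spec_zero (G := G) x h0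
    have hU : U = 1 := by
      by_contra hU
      rw [h1] at h
      exact h4 (h.left_factor hU).mem_type
    have h5 : ofWord G (rotateStep G x).1 = ofWord G x.1 := by rw [h1, h2, hU, one_mul, mul_one]
    rw [Function.iterate_succ_apply, ih _ (rotateStep_snd x), h5]
    rw [rotateStep_get, h5]
    exact h

/-- The conjugator `X` is what remains to be moved: each step divides the current `U` out of it on
the left. When `U` is empty the heap is a pyramid, which forces `X` to be empty and the heap to be
`K`. -/
theorem eventually_rotateStep_zero {K X : Heap G} (x : Σ w : List V, Fin w.length)
    (h0 : x.2.val = 0) (hX : ofWord G x.1 * X = X * K) (hv : x.1.get x.2 ∉ X.type)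
    (hsub : ∀ a ∈ X.type, a ∈ (ofWord G x.1).type) (hK : IsPyr (x.1.get x.2) K) :
    ∃ N, ∀ n ≥ N, ofWord G ((rotateStep G)^[n] x).1 = K := by
  obtain ⟨m, hm⟩ : ∃ m, m = X.size := ⟨_, rfl⟩
  induction m using Nat.strong_induction_on generalizing x X with
  | _ m ih =>
  obtain ⟨U, W, h1, h2, h3, h4⟩ := rotateStep_spec_zero (G := G) x h0
  have hUWX : U * (W * X) = X * K := by rw [← mul_assoc, ← h1, hX]
  by_cases hU : U = 1
  · subst hU
    rw [one_mul] at h1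
    rw [h1] at hX hsub
    have hX1 : X = 1 := by
      by_contra hX1
      have h5 := h3.mul hsub
      rw [hX] at h5
      exact hv (h5.left_factor hX1).mem_type
    subst hX1
    rw [mul_one, one_mul] at hX
    refine ⟨0, fun n _ => ?_⟩
    rw [iterate_rotateStep_of_isPyr x h0 (by rwa [h1]), h1, hX]
  · obtain ⟨p, r, s, q, rfl, -, rfl, rfl, hrs⟩ := levi hUWX
    have hr : r = 1 := by
      by_contra hr
      exact h4 (by rw [type_mul, Multiset.mem_add]; exact Or.inr (hK.left_factor hr).mem_type)
    subst hr
    simp only [mul_one, one_mul] at *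
    have hp := size_pos hU
    obtain ⟨N, hN⟩ := ih s.size (by rw [hm, size_mul]; omega) (rotateStep G x) (X := s)
      (rotateStep_snd x) (by
        refine mul_cancel (A := p) ?_
        rw [h2, ← mul_assoc, ← mul_assoc, ← h1, mul_assoc, hX, mul_assoc])
      (by rw [rotateStep_get]; exact fun h => hv (by rw [type_mul, Multiset.mem_add]; exact Or.inr h))
      (fun a ha => by
        have := hsub a (by simp [ha])
        rw [h1] at this
        rw [h2, type_mul, add_comm, ← type_mul]
        exact this)
      (by rwa [rotateStep_get]) rfl
    refine ⟨N + 1, fun n hn => ?_⟩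
    obtain ⟨n, rfl⟩ : ∃ k, n = k + 1 := ⟨n - 1, by omega⟩
    rw [Function.iterate_succ_apply]
    exact hN n (by omega)

open Classical in
-- Only the first step can start at an inner position. Comparing numbers of pieces at the marked
-- vertex, `U` divides `X` and the quotient avoids that vertex, as the case of a leading piece
-- requires.
theorem eventually_rotateStep {K : Heap G} (x : Σ w : List V, Fin w.length)
    (h : IsRot (ofWord G x.1) (x.1.get x.2) ((x.1.take x.2).count (x.1.get x.2)) K) :
    ∃ N, ∀ n ≥ N, ofWord G ((rotateStep G)^[n] x).1 = K := by
  obtain ⟨U, W, h1, h2, h3, h4⟩ := rotateStep_spec (G := G) x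
  obtain ⟨X, Y, M, hXY, hX, hc, hK⟩ := h
  have hUWX : U * (W * X) = X * K := by rw [← mul_assoc, ← h1, hX]
  obtain ⟨p, r, s, q, rfl, -, rfl, rfl, hrs⟩ := levi hUWX
  rw [← h4, type_mul, type_mul, Multiset.count_add, Multiset.count_add] at hc
  have hr : r = 1 := by
    by_contra hr
    have hr' := (hK.left_factor hr).mem_type
    have h5 := Multiset.count_pos.2 hr'
    have h6 := Multiset.count_eq_zero.2 (hrs.notMem hr')
    omega
  subst hr
  simp only [mul_one, one_mul, type_one, Multiset.count_zero, add_zero] at *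
  have hs : x.1.get x.2 ∉ s.type := Multiset.count_eq_zero.1 (by omega)
  obtain ⟨N, hN⟩ := eventually_rotateStep_zero (rotateStep G x) (X := s) (K := q)
    (rotateStep_snd x) (by
      refine mul_cancel (A := p) ?_
      rw [h2, ← mul_assoc, ← mul_assoc, ← h1, mul_assoc, hX, mul_assoc])
    (by rwa [rotateStep_get])
    (fun a ha => by
      have := mem_type_of_mul_eq_pow hXY (a := a) (Or.inl (by simp [ha]))
      rw [h1] at this
      rw [h2, type_mul, add_comm, ← type_mul]
      exact this)
    (by rwa [rotateStep_get])
  refine ⟨N + 1, fun n hn => ?_⟩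
  obtain ⟨n, rfl⟩ : ∃ k, n = k + 1 := ⟨n - 1, by omega⟩
  rw [Function.iterate_succ_apply]
  exact hN n (by omega)

/-- The process at a piece converges to the unique `IsRot` there, and every conjugate pyramid is one
of these. -/
theorem Heap.isRotation_iff {H K : Heap G} {v : V} (hH : IsPyr v H) :
    H.IsRotation K ↔ IsConjugate H K ∧ ∃ u, IsPyr u K := by
  classical
  constructor
  · rintro ⟨w, p, rfl, N, hN⟩
    have hlt : (w.take p).count (w.get p) < (ofWord G w).type.count (w.get p) := by
      rw [type_ofWord, Multiset.coe_count]
      have h1 : w.count (w.get p) =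
          (w.take p).count (w.get p) + (w.drop p).count (w.get p) := by
        rw [← List.count_append, List.take_append_drop]
      have h2 : 0 < (w.drop p).count (w.get p) := by
        rw [List.count_pos_iff, List.drop_eq_getElem_cons p.isLt]
        exact List.mem_cons_self
      omega
    obtain ⟨K', hK'⟩ := exists_isRot hH.connType hlt
    obtain ⟨N', hN'⟩ := eventually_rotateStep ⟨w, p⟩ hK'
    have : K = K' := (hN (max N N') (le_max_left _ _)).symm.trans (hN' _ (le_max_right _ _))
    subst this
    exact ⟨hK'.isConj, _, hK'.isPyr⟩
  · rintro ⟨hc, u, hu⟩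
    obtain ⟨c, hc, hrot⟩ := hc.exists_isRot hu
    obtain ⟨w, rfl⟩ := exists_ofWord H
    rw [type_ofWord, Multiset.coe_count] at hc
    obtain ⟨p, rfl, rfl⟩ := exists_take_count hc
    exact ⟨w, p, rfl, eventually_rotateStep ⟨w, p⟩ hrot⟩

end Trace

end Kromatic

/-! ### Enumeration of heaps, pyramids and Lyndon heaps -/

namespace Kromatic

open Heap Finset

/-! ### Counting heaps -/

section Count

variable {V : Type*} {G : SimpleGraph V}

open Classical in
/-- The pieces of a heap, recorded by their vertex and the number of earlier pieces there. -/
noncomputable def marks (H : Heap G) : Finset (V × ℕ) :=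
  (H.type.toFinset.sigma fun v => range (H.type.count v)).map
    (Equiv.sigmaEquivProd V ℕ).toEmbedding

open Classical in
theorem mem_marks {H : Heap G} {x : V × ℕ} : x ∈ marks H ↔ x.2 < H.type.count x.1 := by
  obtain ⟨v, c⟩ := x
  simp only [marks, mem_map, mem_sigma, Multiset.mem_toFinset, mem_range,
    Equiv.coe_toEmbedding, Sigma.exists, Equiv.sigmaEquivProd_apply, Prod.mk.injEq]
  constructor
  · rintro ⟨_, _, ⟨-, h⟩, rfl, rfl⟩
    exact h
  · intro h
    exact ⟨v, c, ⟨Multiset.count_pos.1 (by omega), h⟩, rfl, rfl⟩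

theorem card_marks (H : Heap G) : (marks H).card = H.size := by
  classical
  rw [marks, card_map, card_sigma, size]
  simp only [card_range]
  exact Multiset.toFinset_sum_count_eq _

theorem exists_isRot_of_mem_marks {u : V} {H : Heap G} (hH : IsPyr u H) {x : V × ℕ}
    (hx : x ∈ marks H) : ∃ K, IsRot H x.1 x.2 K :=
  exists_isRot hH.connType (mem_marks.1 hx)

theorem Heap.IsConjugate.exists_marks {H K : Heap G} {v : V} (h : IsConjugate H K) (hK : IsPyr v K) :
    ∃ c, (v, c) ∈ marks H ∧ IsRot H v c K := by
  obtain ⟨c, h1, h2⟩ := h.exists_isRot hK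
  exact ⟨c, mem_marks.2 h1, h2⟩

theorem isRot_injective {H K : Heap G} (hK : ¬ K.IsPeriodic) {x y : V × ℕ} (hx : x ∈ marks H)
    (hy : y ∈ marks H) (h : IsRot H x.1 x.2 K) (h' : IsRot H y.1 y.2 K) : x = y := by
  obtain ⟨v, c⟩ := x
  obtain ⟨v', c'⟩ := y
  have hv : v = v' := h.isPyr.root_unique h'.isPyr
  subst hv
  have h1 := h.not_lt h' hK (mem_marks.1 hy)
  have h2 := h'.not_lt h hK (mem_marks.1 hx)
  rw [Prod.mk.injEq]
  exact ⟨rfl, by simp only at h1 h2; omega⟩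

theorem forall_mem_type_mul {W : Finset V} {H K : Heap G} :
    (∀ v ∈ (H * K).type, v ∈ W) ↔ (∀ v ∈ H.type, v ∈ W) ∧ ∀ v ∈ K.type, v ∈ W := by
  simp only [type_mul, Multiset.mem_add]
  exact ⟨fun h => ⟨fun v hv => h v (Or.inl hv), fun v hv => h v (Or.inr hv)⟩,
    fun h v hv => hv.elim (h.1 v) (h.2 v)⟩

variable [Finite V]

theorem finite_size_eq (n : ℕ) : {H : Heap G | H.size = n}.Finite := by
  refine ((List.finite_length_eq V n).image (ofWord G)).subset ?_
  intro H hH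
  obtain ⟨w, rfl⟩ := exists_ofWord H
  refine ⟨w, ?_, rfl⟩
  have : (ofWord G w).size = n := hH
  rwa [size, type_ofWord, Multiset.coe_card] at this

theorem finite_words (H : Heap G) : {w : List V | ofWord G w = H}.Finite := by
  refine (List.finite_length_eq V H.size).subset ?_
  rintro w rfl
  simp [size, type_ofWord]

/-- The heaps of size `n` with pieces at the vertices in `W`. -/
noncomputable def heapsOn (G : SimpleGraph V) (W : Finset V) (n : ℕ) : Finset (Heap G) :=
  ((finite_size_eq (G := G) n).subset
    (fun _ h => h.1 : {H : Heap G | H.size = n ∧ ∀ v ∈ H.type, v ∈ W} ⊆ _)).toFinset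

theorem mem_heapsOn {W : Finset V} {n : ℕ} {H : Heap G} :
    H ∈ heapsOn G W n ↔ H.size = n ∧ ∀ v ∈ H.type, v ∈ W := by
  simp [heapsOn]

open Classical in
/-- The pyramids of size `n` with pieces at the vertices in `W`. -/
noncomputable def pyrOn (G : SimpleGraph V) (W : Finset V) (n : ℕ) : Finset (Heap G) :=
  (heapsOn G W n).filter fun H => ∃ v, IsPyr v H

theorem mem_pyrOn {W : Finset V} {n : ℕ} {H : Heap G} :
    H ∈ pyrOn G W n ↔ (H.size = n ∧ ∀ v ∈ H.type, v ∈ W) ∧ ∃ v, IsPyr v H := by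
  classical
  rw [pyrOn, mem_filter, mem_heapsOn]

open Classical in
/-- The aperiodic pyramids of size `n` with pieces at the vertices in `W`. -/
noncomputable def apyrOn (G : SimpleGraph V) (W : Finset V) (n : ℕ) : Finset (Heap G) :=
  (pyrOn G W n).filter fun H => ¬ H.IsPeriodic

theorem mem_apyrOn {W : Finset V} {n : ℕ} {H : Heap G} :
    H ∈ apyrOn G W n ↔ ((H.size = n ∧ ∀ v ∈ H.type, v ∈ W) ∧ ∃ v, IsPyr v H) ∧
      ¬ H.IsPeriodic := by
  classical
  rw [apyrOn, mem_filter, mem_pyrOn]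

/-- Cutting a heap at a marked piece. -/
theorem mul_card_heapsOn (W : Finset V) (n : ℕ) : n * (heapsOn G W n).card =
    ∑ x ∈ antidiagonal n, (heapsOn G W x.1).card * (pyrOn G W x.2).card := by
  classical
  have h1 : n * (heapsOn G W n).card = ((heapsOn G W n).sigma fun H => marks H).card := by
    rw [card_sigma, sum_congr rfl fun H hH => (card_marks H).trans (mem_heapsOn.1 hH).1,
      sum_const, smul_eq_mul, mul_comm]
  have h2 : ∑ x ∈ antidiagonal n, (heapsOn G W x.1).card * (pyrOn G W x.2).card =
      ((antidiagonal n).sigma fun x => heapsOn G W x.1 ×ˢ pyrOn G W x.2).card := by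
    rw [card_sigma]
    simp only [card_product]
  rw [h1, h2]
  symm
  have hpyr : ∀ a ∈ (antidiagonal n).sigma fun x => heapsOn G W x.1 ×ˢ pyrOn G W x.2,
      ∃ v, IsPyr v a.2.2 := by
    intro a ha
    rw [mem_sigma, mem_product] at ha
    exact (mem_pyrOn.1 ha.2.2).2
  refine card_bij (fun a ha => ⟨a.2.1 * a.2.2,
    ((hpyr a ha).choose, a.2.1.type.count (hpyr a ha).choose)⟩) ?_ ?_ ?_
  · intro a ha
    have hs := (hpyr a ha).choose_spec
    rw [mem_sigma, mem_product, mem_heapsOn, mem_pyrOn, HasAntidiagonal.mem_antidiagonal] at ha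
    rw [mem_sigma, mem_heapsOn, mem_marks]
    refine ⟨⟨?_, forall_mem_type_mul.2 ⟨ha.2.1.2, ha.2.2.1.2⟩⟩, ?_⟩
    · rw [size_mul, ha.2.1.1, ha.2.2.1.1, ha.1]
    · have := Multiset.count_pos.2 hs.mem_type
      simp only [type_mul, Multiset.count_add]
      omega
  · intro a ha b hb h
    have hs := (hpyr a ha).choose_spec
    have hs' := (hpyr b hb).choose_spec
    rw [Sigma.mk.injEq, heq_eq_eq, Prod.mk.injEq] at h
    obtain ⟨h1, h2, h3⟩ := h
    rw [← h2] at hs' h3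
    obtain ⟨h4, h5⟩ := decomp_unique hs hs' h1 h3
    rw [mem_sigma, mem_product, mem_heapsOn, mem_pyrOn] at ha hb
    obtain ⟨⟨i, j⟩, U, P⟩ := a
    obtain ⟨⟨i', j'⟩, U', P'⟩ := b
    simp only at h4 h5 ha hb
    subst h4 h5
    rw [← ha.2.1.1, ← hb.2.1.1, ← ha.2.2.1.1, ← hb.2.2.1.1]
  · rintro ⟨H, v, c⟩ hH
    rw [mem_sigma, mem_heapsOn, mem_marks] at hH
    obtain ⟨U, P, rfl, hP, hc⟩ := exists_decomp hH.2
    have hW := forall_mem_type_mul.1 hH.1.2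
    have hmem : (⟨(U.size, P.size), (U, P)⟩ : Σ _ : ℕ × ℕ, Heap G × Heap G) ∈
        (antidiagonal n).sigma fun x => heapsOn G W x.1 ×ˢ pyrOn G W x.2 := by
      rw [mem_sigma, mem_product, mem_heapsOn, mem_pyrOn, HasAntidiagonal.mem_antidiagonal]
      exact ⟨by rw [← hH.1.1, size_mul], ⟨rfl, hW.1⟩, ⟨rfl, hW.2⟩, v, hP⟩
    refine ⟨_, hmem, ?_⟩
    have hv : (hpyr _ hmem).choose = v := (hpyr _ hmem).choose_spec.root_unique hP
    rw [hv, hc]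

/-- Existence and uniqueness of the aperiodic root make `K ↦ K ^ (n / d)` a bijection. -/
theorem card_pyrOn (W : Finset V) {n : ℕ} (hn : n ≠ 0) :
    (pyrOn G W n).card = ∑ d ∈ n.divisors, (apyrOn G W d).card := by
  rw [← card_sigma]
  symm
  refine card_bij (fun a _ => a.2 ^ (n / a.1)) ?_ ?_ ?_
  · rintro ⟨d, K⟩ ha
    simp only [mem_sigma, mem_apyrOn, Nat.mem_divisors] at ha
    obtain ⟨⟨hd, -⟩, ⟨⟨hs, hW⟩, v, hv⟩, -⟩ := ha
    have hnd : n / d ≠ 0 := (Nat.div_pos (Nat.le_of_dvd (Nat.pos_of_ne_zero hn) hd)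
      (Nat.pos_of_dvd_of_pos hd (Nat.pos_of_ne_zero hn))).ne'
    rw [mem_pyrOn]
    refine ⟨⟨?_, fun u hu => ?_⟩, v, hv.pow hnd⟩
    · rw [size_pow, hs]
      exact Nat.div_mul_cancel hd
    · rw [type_pow] at hu
      exact hW u (Multiset.mem_of_mem_nsmul hu)
  · rintro ⟨d, K⟩ ha ⟨d', K'⟩ hb h
    simp only [mem_sigma, mem_apyrOn, Nat.mem_divisors] at ha hb h
    obtain ⟨⟨hd, -⟩, ⟨⟨hs, -⟩, v, hv⟩, hK⟩ := ha
    obtain ⟨⟨hd', -⟩, ⟨⟨hs', -⟩, v', hv'⟩, hK'⟩ := hb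
    have hnd : n / d ≠ 0 := (Nat.div_pos (Nat.le_of_dvd (Nat.pos_of_ne_zero hn) hd)
      (Nat.pos_of_dvd_of_pos hd (Nat.pos_of_ne_zero hn))).ne'
    have hnd' : n / d' ≠ 0 := (Nat.div_pos (Nat.le_of_dvd (Nat.pos_of_ne_zero hn) hd')
      (Nat.pos_of_dvd_of_pos hd' (Nat.pos_of_ne_zero hn))).ne'
    have hvv : v = v' := (hv.pow hnd).root_unique (h ▸ hv'.pow hnd')
    subst hvv
    have hKK := root_unique hv hv' hK hK' hnd hnd' h
    subst hKK
    rw [← hs, ← hs']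
  · intro P hP
    rw [mem_pyrOn] at hP
    obtain ⟨⟨hs, hW⟩, v, hv⟩ := hP
    obtain ⟨K, k, hk, hKv, hK, rfl⟩ := exists_aperiodic_root hv
    rw [size_pow] at hs
    have hpos := size_pos hKv.ne_one
    refine ⟨⟨K.size, K⟩, ?_, ?_⟩
    · simp only [mem_sigma, mem_apyrOn, Nat.mem_divisors]
      refine ⟨⟨⟨k, by rw [← hs, mul_comm]⟩, hn⟩, ⟨⟨trivial, fun u hu => hW u ?_⟩, v, hKv⟩, hK⟩
      rwa [type_pow, Multiset.mem_nsmul_of_ne_zero hk]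
    · simp only [← hs, Nat.mul_div_cancel _ hpos]

end Count

/-! ### Lyndon heaps -/

section Lyndon

variable {V : Type*} [LinearOrder V] {G : SimpleGraph V}

theorem isLyndon_iff {H : Heap G} : H.IsLyndon ↔ (∃ v, IsPyr v H) ∧ ¬ H.IsPeriodic ∧
    ∀ K, IsConjugate H K → (∃ u, IsPyr u K) → H.StdLE K := by
  rw [IsLyndon, isPyramid_iff]
  refine and_congr_right fun ⟨v, hv⟩ => and_congr_right fun _ => forall_congr' fun K => ?_
  rw [isRotation_iff hv, and_imp]

theorem Heap.IsLyndon.ne_one {H : Heap G} (h : H.IsLyndon) : H ≠ 1 := by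
  obtain ⟨⟨v, hv⟩, -⟩ := isLyndon_iff.1 h
  exact hv.ne_one

variable [Finite V]

theorem exists_isStandardWord (H : Heap G) : ∃ w, H.IsStandardWord w := by
  obtain ⟨w, hw, hmax⟩ := Set.exists_max_image _ id (finite_words H) (exists_ofWord H)
  exact ⟨w, hw, fun u hu => hmax u hu⟩

/-- The standard word of a heap. -/
noncomputable def stdWord (H : Heap G) : List V := (exists_isStandardWord H).choose

theorem isStandardWord_stdWord (H : Heap G) : H.IsStandardWord (stdWord H) :=
  (exists_isStandardWord H).choose_spec

theorem stdLE_iff {H K : Heap G} : H.StdLE K ↔ stdWord H ≤ stdWord K := by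
  have huniq : ∀ (H : Heap G) (w : List V), H.IsStandardWord w → w = stdWord H := fun H w hw =>
    le_antisymm ((isStandardWord_stdWord H).2 w hw.1) (hw.2 _ (isStandardWord_stdWord H).1)
  constructor
  · rintro ⟨u, w, hu, hw, h⟩
    rwa [← huniq H u hu, ← huniq K w hw]
  · exact fun h => ⟨_, _, isStandardWord_stdWord H, isStandardWord_stdWord K, h⟩

theorem stdLE_antisymm {H K : Heap G} (h : H.StdLE K) (h' : K.StdLE H) : H = K := by
  rw [← (isStandardWord_stdWord H).1, ← (isStandardWord_stdWord K).1,
    le_antisymm (stdLE_iff.1 h) (stdLE_iff.1 h')]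

open Classical in
/-- The Lyndon heaps of size `n` with pieces at the vertices in `W`. -/
noncomputable def lynOn (G : SimpleGraph V) (W : Finset V) (n : ℕ) : Finset (Heap G) :=
  (heapsOn G W n).filter fun H => H.IsLyndon

theorem mem_lynOn {W : Finset V} {n : ℕ} {H : Heap G} :
    H ∈ lynOn G W n ↔ (H.size = n ∧ ∀ v ∈ H.type, v ∈ W) ∧ H.IsLyndon := by
  classical
  rw [lynOn, mem_filter, mem_heapsOn]

theorem Heap.IsConjugate.isLyndon_unique {H K : Heap G} (h : IsConjugate H K) (hH : H.IsLyndon)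
    (hK : K.IsLyndon) : H = K := by
  rw [isLyndon_iff] at hH hK
  exact stdLE_antisymm (hH.2.2 K h hK.1) (hK.2.2 H h.symm hH.1)

theorem exists_isLyndon_isConj {K : Heap G} {v : V} (hK : IsPyr v K) (hK' : ¬ K.IsPeriodic) :
    ∃ L : Heap G, L.IsLyndon ∧ IsConjugate L K := by
  have hfin : {L : Heap G | IsConjugate L K ∧ ∃ u, IsPyr u L}.Finite :=
    (finite_size_eq (G := G) K.size).subset fun L hL => by
      change L.size = K.size
      rw [size, size, hL.1.type_eq]
  obtain ⟨L, hL, hmin⟩ := Set.exists_min_image _ stdWord hfin ⟨K, IsConjugate.refl K, v, hK⟩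
  refine ⟨L, isLyndon_iff.2 ⟨hL.2, fun h => hK' (hL.1.isPeriodic h), fun M hM hM' => ?_⟩, hL.1⟩
  exact stdLE_iff.2 (hmin M ⟨hM.symm.trans hL.1, hM'⟩)

/-- A Lyndon heap with a marked piece corresponds to its rotation there: each class contains exactly
one Lyndon heap, and different pieces of an aperiodic heap give different rotations. -/
theorem card_apyrOn (W : Finset V) (n : ℕ) :
    (apyrOn G W n).card = n * (lynOn G W n).card := by
  have h1 : n * (lynOn G W n).card = ((lynOn G W n).sigma fun H => marks H).card := by
    rw [card_sigma, sum_congr rfl fun H hH => (card_marks H).trans (mem_lynOn.1 hH).1.1,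
      sum_const, smul_eq_mul, mul_comm]
  rw [h1]
  symm
  have hrot : ∀ a ∈ (lynOn G W n).sigma fun H => marks H, ∃ K, IsRot a.1 a.2.1 a.2.2 K := by
    intro a ha
    rw [mem_sigma, mem_lynOn, isLyndon_iff] at ha
    obtain ⟨⟨-, ⟨v, hv⟩, -⟩, hm⟩ := ha
    exact exists_isRot_of_mem_marks hv hm
  refine card_bij (fun a ha => (hrot a ha).choose) ?_ ?_ ?_
  · intro a ha
    have hs := (hrot a ha).choose_spec
    rw [mem_sigma, mem_lynOn, isLyndon_iff] at ha
    rw [mem_apyrOn, size, ← hs.isConj.type_eq]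
    exact ⟨⟨ha.1.1, _, hs.isPyr⟩, fun h => ha.1.2.2.1 (hs.isConj.symm.isPeriodic h)⟩
  · intro a ha b hb h
    have hs := (hrot a ha).choose_spec
    have hs' := (hrot b hb).choose_spec
    rw [← h] at hs'
    rw [mem_sigma, mem_lynOn] at ha hb
    have hab := (hs.isConj.trans hs'.isConj.symm).isLyndon_unique ha.1.2 hb.1.2
    obtain ⟨H, x⟩ := a
    obtain ⟨H', y⟩ := b
    simp only at hab hs hs' ha hb
    subst hab
    rw [isRot_injective (fun h => (isLyndon_iff.1 ha.1.2).2.1 (hs.isConj.symm.isPeriodic h))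
      ha.2 hb.2 hs hs']
  · intro K hK
    rw [mem_apyrOn] at hK
    obtain ⟨⟨hW, v, hv⟩, hap⟩ := hK
    obtain ⟨L, hL, hLK⟩ := exists_isLyndon_isConj hv hap
    obtain ⟨c, hc, hr⟩ := hLK.exists_marks hv
    have hmem : (⟨L, (v, c)⟩ : Σ _ : Heap G, V × ℕ) ∈ (lynOn G W n).sigma fun H => marks H := by
      rw [mem_sigma, mem_lynOn, size, hLK.type_eq]
      exact ⟨⟨hW, hL⟩, hc⟩
    exact ⟨_, hmem, (hrot _ hmem).choose_spec.unique hr⟩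

theorem card_pyrOn_eq_sum_lynOn (W : Finset V) {n : ℕ} (hn : n ≠ 0) :
    (pyrOn G W n).card = ∑ d ∈ n.divisors, d * (lynOn G W d).card := by
  rw [card_pyrOn W hn]
  exact sum_congr rfl fun d _ => card_apyrOn W d

end Lyndon

/-! ### Independent sets and the inversion formula -/

section Inversion

variable {V : Type*} {G : SimpleGraph V}

theorem indep_of_isSource {H : Heap G} {a b : V} (ha : IsSource a H) (hb : IsSource b H)
    (hab : a ≠ b) : Indep G a b := by
  obtain ⟨K, rfl⟩ := hb
  exact ((isSource_piece_mul.1 ha).resolve_left hab).1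

theorem exists_eq_ofWord_mul {l : List V} (hl : l.Nodup) {H : Heap G}
    (h : ∀ a ∈ l, IsSource a H) : ∃ K, H = ofWord G l * K := by
  induction l generalizing H with
  | nil => exact ⟨H, by simp⟩
  | cons a l ih =>
    obtain ⟨K, rfl⟩ := h a (by simp)
    rw [List.nodup_cons] at hl
    obtain ⟨L, rfl⟩ := ih hl.2 (H := K) fun b hb =>
      ((isSource_piece_mul.1 (h b (by simp [hb]))).resolve_left
        (by rintro rfl; exact hl.1 hb)).2
    exact ⟨L, by rw [ofWord_cons, mul_assoc]⟩

theorem isSource_ofWord_of_pairwise {l : List V} (hl : l.Nodup)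
    (h : ∀ u ∈ l, ∀ v ∈ l, ¬ G.Adj u v) {a : V} (ha : a ∈ l) : IsSource a (ofWord G l) := by
  induction l with
  | nil => simp at ha
  | cons b l ih =>
    rw [ofWord_cons, isSource_piece_mul]
    by_cases hab : a = b
    · exact Or.inl hab
    · have ha' : a ∈ l := (List.mem_cons.1 ha).resolve_left hab
      exact Or.inr ⟨⟨hab, h a ha b (by simp)⟩, ih (List.nodup_cons.1 hl).2
        (fun u hu v hv => h u (by simp [hu]) v (by simp [hv])) ha'⟩

variable [Fintype V]

open Classical in
/-- The independent sets of size `k` contained in `W`. -/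
noncomputable def indepOn (G : SimpleGraph V) (W : Finset V) (k : ℕ) : Finset (Finset V) :=
  (W.powersetCard k).filter fun S => ∀ u ∈ S, ∀ v ∈ S, ¬ G.Adj u v

theorem mem_indepOn {W : Finset V} {k : ℕ} {S : Finset V} :
    S ∈ indepOn G W k ↔ (S ⊆ W ∧ S.card = k) ∧ ∀ u ∈ S, ∀ v ∈ S, ¬ G.Adj u v := by
  classical
  rw [indepOn, mem_filter, mem_powersetCard]

open Classical in
/-- The vertices of the sources of a heap. -/
noncomputable def sources (H : Heap G) : Finset V := univ.filter fun a => IsSource a H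

theorem mem_sources {H : Heap G} {a : V} : a ∈ sources H ↔ IsSource a H := by
  classical
  simp [sources]

/-- Cartier–Foata inversion: an independent set followed by a heap is a heap with a marked set of
sources, and the alternating sum over sets of sources vanishes unless the heap is empty. -/
theorem sum_indepOn_mul_heapsOn (W : Finset V) (n : ℕ) :
    ∑ x ∈ antidiagonal n, (-1 : ℤ) ^ x.1 * (indepOn G W x.1).card * (heapsOn G W x.2).card =
      if n = 0 then 1 else 0 := by
  classical
  have h1 : ∑ x ∈ antidiagonal n,
      (-1 : ℤ) ^ x.1 * (indepOn G W x.1).card * (heapsOn G W x.2).card =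
      ∑ x ∈ antidiagonal n, ∑ y ∈ indepOn G W x.1 ×ˢ heapsOn G W x.2, (-1 : ℤ) ^ x.1 := by
    refine sum_congr rfl fun x _ => ?_
    rw [sum_const, card_product, nsmul_eq_mul]
    push_cast
    ring
  have h2 : ∑ H ∈ heapsOn G W n, ∑ S ∈ (sources H).powerset, (-1 : ℤ) ^ S.card =
      if n = 0 then 1 else 0 := by
    simp only [sum_powerset_neg_one_pow_card]
    have hs : ∀ H : Heap G, sources H = ∅ ↔ H = 1 := by
      intro H
      constructor
      · intro h
        by_contra h1
        obtain ⟨a, ha⟩ := exists_isSource h1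
        have := mem_sources.2 ha
        rw [h] at this
        simp at this
      · rintro rfl
        exact eq_empty_of_forall_notMem fun a ha => not_isSource_one a (mem_sources.1 ha)
    simp only [hs]
    rw [sum_ite_eq']
    congr 1
    rw [mem_heapsOn]
    simp [eq_comm]
  rw [h1, ← h2, sum_sigma', sum_sigma']
  refine sum_bij (fun a _ => ⟨ofWord G a.2.1.toList * a.2.2, a.2.1⟩) ?_ ?_ ?_ ?_
  · rintro ⟨⟨i, j⟩, S, K⟩ ha
    simp only [mem_sigma, mem_product, HasAntidiagonal.mem_antidiagonal, mem_indepOn, mem_heapsOn,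
      mem_powerset] at ha ⊢
    obtain ⟨hn, ⟨⟨hSW, hS⟩, hSi⟩, hK, hKW⟩ := ha
    refine ⟨⟨?_, forall_mem_type_mul.2 ⟨fun v hv => hSW ?_, hKW⟩⟩, fun a haS => ?_⟩
    · rw [size_mul, hK, size_ofWord, length_toList, hS, hn]
    · simpa [type_ofWord] using hv
    · rw [mem_sources]
      exact (isSource_ofWord_of_pairwise (nodup_toList S) (by simpa using hSi)
        (by simpa using haS)).mul_right K
  · rintro ⟨⟨i, j⟩, S, K⟩ ha ⟨⟨i', j'⟩, S', K'⟩ hb h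
    simp only [mem_sigma, mem_product, mem_indepOn, mem_heapsOn] at ha hb
    simp only [Sigma.mk.injEq, heq_eq_eq] at h
    obtain ⟨h, rfl⟩ := h
    have := mul_cancel h
    subst this
    rw [← ha.2.1.1.2, ← hb.2.1.1.2, ← ha.2.2.1, ← hb.2.2.1]
  · rintro ⟨H, S⟩ hH
    simp only [mem_sigma, mem_heapsOn, mem_powerset] at hH
    obtain ⟨⟨hn, hW⟩, hS⟩ := hH
    obtain ⟨K, rfl⟩ := exists_eq_ofWord_mul (nodup_toList S) (H := H) fun a ha =>
      mem_sources.1 (hS (by simpa using ha))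
    have hW' := forall_mem_type_mul.1 hW
    refine ⟨⟨(S.card, K.size), S, K⟩, ?_, rfl⟩
    simp only [mem_sigma, mem_product, HasAntidiagonal.mem_antidiagonal, mem_indepOn, mem_heapsOn]
    refine ⟨?_, ⟨⟨fun v hv => hW'.1 v (by simpa [type_ofWord] using hv), trivial⟩,
      fun u hu v hv huv => ?_⟩, trivial, hW'.2⟩
    · rw [← hn, size_mul, size_ofWord, length_toList]
    · exact (indep_of_isSource (mem_sources.1 (hS hu)) (mem_sources.1 (hS hv)) huv.ne).2 huv
  · rintro ⟨⟨i, j⟩, S, K⟩ ha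
    simp only [mem_sigma, mem_product, mem_indepOn] at ha
    simp only
    rw [ha.2.1.1.2]

end Inversion

end Kromatic

/-! ### Factorization of the independence polynomial over Lyndon heaps -/

namespace Kromatic

open Heap Finset PowerSeries

/-! ### Power series up to a given degree -/

section TruncEq

variable {R : Type*} [CommRing R]

/-- Equality of the coefficients up to degree `N`. -/
def TruncEq (N : ℕ) (f g : R⟦X⟧) : Prop := ∀ n ≤ N, coeff n f = coeff n g

theorem TruncEq.refl (N : ℕ) (f : R⟦X⟧) : TruncEq N f f := fun _ _ => rfl

theorem TruncEq.symm {N : ℕ} {f g : R⟦X⟧} (h : TruncEq N f g) : TruncEq N g f :=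
  fun n hn => (h n hn).symm

theorem TruncEq.trans {N : ℕ} {f g h : R⟦X⟧} (h1 : TruncEq N f g) (h2 : TruncEq N g h) :
    TruncEq N f h := fun n hn => (h1 n hn).trans (h2 n hn)

theorem TruncEq.mul {N : ℕ} {f g f' g' : R⟦X⟧} (h : TruncEq N f g) (h' : TruncEq N f' g') :
    TruncEq N (f * f') (g * g') := by
  intro n hn
  rw [coeff_mul, coeff_mul]
  refine sum_congr rfl fun x hx => ?_
  rw [HasAntidiagonal.mem_antidiagonal] at hx
  rw [h _ (by omega), h' _ (by omega)]

theorem TruncEq.prod {ι : Type*} {N : ℕ} (s : Finset ι) {f g : ι → R⟦X⟧}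
    (h : ∀ i ∈ s, TruncEq N (f i) (g i)) : TruncEq N (∏ i ∈ s, f i) (∏ i ∈ s, g i) := by
  classical
  induction s using Finset.induction_on with
  | empty => exact TruncEq.refl _ _
  | insert a s ha ih =>
    rw [prod_insert ha, prod_insert ha]
    exact (h a (mem_insert_self _ _)).mul (ih fun i hi => h i (mem_insert_of_mem hi))

theorem TruncEq.rescale {N : ℕ} {f g : R⟦X⟧} (h : TruncEq N f g) (a : R) :
    TruncEq N (PowerSeries.rescale a f) (PowerSeries.rescale a g) := by
  intro n hn
  rw [coeff_rescale, coeff_rescale, h n hn]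

end TruncEq

/-! ### The Euler derivation -/

section Euler

/-- The derivation `x d/dx`. -/
noncomputable def euler (f : ℚ⟦X⟧) : ℚ⟦X⟧ := X * derivative ℚ f

theorem coeff_euler (f : ℚ⟦X⟧) (n : ℕ) : coeff n (euler f) = n * coeff n f := by
  cases n with
  | zero => simp [euler]
  | succ n =>
    rw [euler, coeff_succ_X_mul, coeff_derivative]
    push_cast
    ring

theorem euler_mul (f g : ℚ⟦X⟧) : euler (f * g) = euler f * g + f * euler g := by
  simp only [euler, Derivation.leibniz, smul_eq_mul]
  ring

theorem euler_prod {ι : Type*} (s : Finset ι) (f a : ι → ℚ⟦X⟧)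
    (h : ∀ i ∈ s, euler (f i) = f i * a i) :
    euler (∏ i ∈ s, f i) = (∏ i ∈ s, f i) * ∑ i ∈ s, a i := by
  classical
  induction s using Finset.induction_on with
  | empty => simp [euler]
  | insert b s hb ih =>
    rw [prod_insert hb, sum_insert hb, euler_mul, h b (mem_insert_self _ _),
      ih fun i hi => h i (mem_insert_of_mem hi)]
    ring

/-- The series `x ^ d / (1 - x ^ d)`. -/
noncomputable def multiples (d : ℕ) : ℚ⟦X⟧ := PowerSeries.mk fun n => if d ∣ n ∧ n ≠ 0 then 1 else 0

theorem one_sub_X_pow_mul_multiples {d : ℕ} (hd : d ≠ 0) :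
    (1 - X ^ d) * multiples d = X ^ d := by
  ext n
  rw [sub_mul, one_mul, map_sub, coeff_X_pow_mul', coeff_X_pow, multiples, coeff_mk]
  by_cases hdn : d ≤ n
  · rw [if_pos hdn, coeff_mk]
    have h1 : d ∣ n - d ↔ d ∣ n := by
      obtain ⟨m, rfl⟩ := Nat.exists_eq_add_of_le hdn
      simp
    by_cases h2 : n = d
    · subst h2
      simp [hd]
    · have h3 : n ≠ 0 := by omega
      have h4 : n - d ≠ 0 := by omega
      simp [h1, h2, h3, h4]
  · rw [if_neg hdn]
    have h2 : n ≠ d := by omega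
    have h3 : ¬ (d ∣ n ∧ n ≠ 0) := fun h => hdn (Nat.le_of_dvd (Nat.pos_of_ne_zero h.2) h.1)
    simp [h2, h3]

theorem euler_one_sub_X_pow {d : ℕ} (hd : d ≠ 0) :
    euler (1 - X ^ d) = (1 - X ^ d) * (-(d : ℚ) • multiples d) := by
  rw [mul_smul_comm, one_sub_X_pow_mul_multiples hd]
  ext n
  rw [coeff_euler, map_sub, coeff_X_pow, coeff_one, map_smul, coeff_X_pow, smul_eq_mul]
  by_cases h : n = d
  · subst h
    simp [hd]
  · by_cases h0 : n = 0
    · simp [h0, hd.symm]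
    · simp [h, h0]

/-- A series whose logarithmic Euler derivative vanishes up to degree `N` is constant up to
degree `N`. -/
theorem truncEq_one_of_euler {N : ℕ} {f a : ℚ⟦X⟧} (h0 : coeff 0 f = 1) (h : euler f = f * a)
    (ha : ∀ n ≤ N, coeff n a = 0) : TruncEq N f 1 := by
  intro n hn
  rcases Nat.eq_zero_or_pos n with rfl | hpos
  · rw [h0, coeff_zero_one]
  · have h1 := coeff_euler f n
    rw [h, coeff_mul, sum_eq_zero] at h1
    · rw [coeff_one, if_neg hpos.ne']
      have : (n : ℚ) ≠ 0 := by exact_mod_cast hpos.ne'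
      exact (mul_eq_zero.1 h1.symm).resolve_left this
    · intro x hx
      rw [HasAntidiagonal.mem_antidiagonal] at hx
      rw [ha _ (by omega), mul_zero]

theorem one_sub_X_pow_mul_prod (s J : ℕ) :
    (1 - X ^ s) * ∏ j ∈ range J, (1 + X ^ (2 ^ j * s)) = (1 - X ^ (2 ^ J * s) : ℚ⟦X⟧) := by
  induction J with
  | zero => simp
  | succ J ih =>
    rw [prod_range_succ, ← mul_assoc, ih, pow_succ, mul_comm (2 ^ J) 2, mul_assoc, two_mul, pow_add]
    ring

open Classical in
-- The product telescopes to `1 - X ^ (2 ^ J * s)`. With the least `J` such that `N < 2 ^ J * s`,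
-- exactly the factors of exponent at most `N` occur.
theorem truncEq_one_sub_mul_prod {s : ℕ} (hs : s ≠ 0) (N : ℕ) :
    TruncEq N ((1 - X ^ s) * ∏ k ∈ range (N + 1) with ∃ j, k = 2 ^ j * s, (1 + X ^ k))
      (1 : ℚ⟦X⟧) := by
  have hex : ∃ J, N < 2 ^ J * s := by
    refine ⟨N, (Nat.lt_two_pow_self (n := N)).trans_le ?_⟩
    exact Nat.le_mul_of_pos_right _ (Nat.pos_of_ne_zero hs)
  have hmono : ∀ i j, 2 ^ i * s ≤ 2 ^ j * s ↔ i ≤ j := fun i j => by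
    rw [Nat.mul_le_mul_right_iff (Nat.pos_of_ne_zero hs), Nat.pow_le_pow_iff_right one_lt_two]
  have himg : (range (N + 1)).filter (fun k => ∃ j, k = 2 ^ j * s) =
      (range (Nat.find hex)).image fun j => 2 ^ j * s := by
    ext k
    simp only [mem_filter, mem_range, mem_image]
    constructor
    · rintro ⟨hk, j, rfl⟩
      refine ⟨j, ?_, rfl⟩
      by_contra hj
      have h1 := Nat.find_spec hex
      have h2 := (hmono _ _).2 (not_lt.1 hj)
      omega
    · rintro ⟨j, hj, rfl⟩
      have := Nat.find_min hex hj
      exact ⟨by omega, j, rfl⟩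
  rw [himg, prod_image, one_sub_X_pow_mul_prod]
  · intro n hn
    have h1 := Nat.find_spec hex
    have h2 : n ≠ 2 ^ Nat.find hex * s := by omega
    rw [map_sub, coeff_X_pow, if_neg h2, sub_zero]
  · intro i _ j _ h
    exact le_antisymm ((hmono i j).1 h.le) ((hmono j i).1 h.ge)

end Euler

/-! ### The independence polynomial -/

section Independence

variable {V : Type*} {G : SimpleGraph V}

/-- The Lyndon heap `L` may be attached to the part `k`. -/
def Attachable (x : ℕ × Heap G) : Prop :=
  x.2.size = x.1 ∨ Even x.2.size ∧ ∃ j : ℕ, 1 ≤ j ∧ x.1 = 2 ^ j * x.2.size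

theorem Attachable.size_le {x : ℕ × Heap G} (h : Attachable x) : x.2.size ≤ x.1 := by
  rcases h with h | ⟨-, j, -, h⟩
  · exact h.le
  · rw [h]
    exact Nat.le_mul_of_pos_left _ (by positivity)

variable [Fintype V] [LinearOrder V]

/-- The independence polynomial of the subgraph induced on `W`. -/
noncomputable def indepSeries (G : SimpleGraph V) (W : Finset V) : ℚ⟦X⟧ :=
  PowerSeries.mk fun k => ((indepOn G W k).card : ℚ)

open Classical in
/-- The Lyndon heaps of size at most `N` with pieces at the vertices in `W`. -/
noncomputable def lynUpTo (G : SimpleGraph V) (W : Finset V) (N : ℕ) : Finset (Heap G) :=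
  (range (N + 1)).biUnion fun n => lynOn G W n

theorem mem_lynUpTo {W : Finset V} {N : ℕ} {H : Heap G} :
    H ∈ lynUpTo G W N ↔ H.size ≤ N ∧ (∀ v ∈ H.type, v ∈ W) ∧ H.IsLyndon := by
  classical
  simp only [lynUpTo, mem_biUnion, mem_range, mem_lynOn]
  constructor
  · rintro ⟨n, hn, ⟨rfl, h1⟩, h2⟩
    exact ⟨by omega, h1, h2⟩
  · rintro ⟨h1, h2, h3⟩
    exact ⟨H.size, by omega, ⟨rfl, h2⟩, h3⟩

theorem coeff_sum_multiples (W : Finset V) {N n : ℕ} (hn : n ≤ N) :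
    coeff n (∑ L ∈ lynUpTo G W N, (L.size : ℚ) • multiples L.size) = ((pyrOn G W n).card : ℚ) := by
  classical
  rw [map_sum]
  simp only [map_smul, multiples, coeff_mk, smul_eq_mul]
  rcases Nat.eq_zero_or_pos n with rfl | hpos
  · have : pyrOn G W 0 = ∅ := eq_empty_of_forall_notMem fun H hH => by
      obtain ⟨⟨h0, -⟩, v, hv⟩ := mem_pyrOn.1 hH
      exact hv.ne_one (eq_one_of_size_eq_zero h0)
    simp [this]
  · rw [card_pyrOn_eq_sum_lynOn W hpos.ne']
    simp only [mul_ite, mul_one, mul_zero]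
    rw [← sum_filter, ← sum_fiberwise_of_maps_to (t := n.divisors) (g := Heap.size)]
    · push_cast
      refine sum_congr rfl fun d hd => ?_
      have hfil : ((lynUpTo G W N).filter (fun L => L.size ∣ n ∧ n ≠ 0)).filter
          (fun L => L.size = d) = lynOn G W d := by
        ext L
        simp only [mem_filter, mem_lynUpTo, mem_lynOn]
        constructor
        · rintro ⟨⟨⟨-, h1, h2⟩, -⟩, h3⟩
          exact ⟨⟨h3, h1⟩, h2⟩
        · rintro ⟨⟨rfl, h1⟩, h2⟩
          rw [Nat.mem_divisors] at hd
          exact ⟨⟨⟨(Nat.le_of_dvd hpos hd.1).trans hn, h1, h2⟩, hd⟩, rfl⟩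
      rw [hfil, sum_congr rfl fun L hL => by rw [(mem_lynOn.1 hL).1.1], sum_const, nsmul_eq_mul,
        mul_comm]
    · intro L hL
      rw [mem_filter] at hL
      exact Nat.mem_divisors.2 hL.2

/-- The logarithmic Euler derivative of `A * F` is `P` minus the Lyndon sum, which vanishes up to
degree `N`; so `A` inverts `F` there, as does the independence series at `-X`. -/
theorem truncEq_indepSeries (W : Finset V) (N : ℕ) :
    TruncEq N (indepSeries G W) (∏ L ∈ lynUpTo G W N, (1 - (-X) ^ L.size)) := by
  set F : ℚ⟦X⟧ := PowerSeries.mk fun n => ((heapsOn G W n).card : ℚ) with hF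
  set P : ℚ⟦X⟧ := PowerSeries.mk fun n => ((pyrOn G W n).card : ℚ) with hP
  set A : ℚ⟦X⟧ := ∏ L ∈ lynUpTo G W N, (1 - X ^ L.size) with hA
  have hpos : ∀ L ∈ lynUpTo G W N, L.size ≠ 0 := fun L hL h0 =>
    (mem_lynUpTo.1 hL).2.2.ne_one (eq_one_of_size_eq_zero h0)
  have h1 : euler F = F * P := by
    ext n
    rw [coeff_euler, coeff_mul, hF, hP]
    simp only [coeff_mk]
    exact_mod_cast mul_card_heapsOn (G := G) W n
  have h2 : PowerSeries.rescale (-1) (indepSeries G W) * F = 1 := by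
    ext n
    rw [coeff_mul, coeff_one, hF]
    simp only [coeff_rescale, indepSeries, coeff_mk]
    exact_mod_cast sum_indepOn_mul_heapsOn (G := G) W n
  have h3 : euler A = A * -∑ L ∈ lynUpTo G W N, (L.size : ℚ) • multiples L.size := by
    rw [hA, euler_prod _ _ (fun L => -(L.size : ℚ) • multiples L.size)
      fun L hL => euler_one_sub_X_pow (hpos L hL), ← sum_neg_distrib]
    simp only [neg_smul]
  have h4 : TruncEq N (A * F) 1 := by
    refine truncEq_one_of_euler (a := P - ∑ L ∈ lynUpTo G W N, (L.size : ℚ) • multiples L.size)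
      ?_ ?_ ?_
    · have hF0 : coeff 0 F = 1 := by
        have := congrArg (coeff 0) h2
        have hI : coeff 0 (PowerSeries.rescale (-1) (indepSeries G W)) = 1 := by
          have : indepOn G W 0 = {∅} := by
            ext S
            rw [mem_indepOn, mem_singleton, card_eq_zero]
            constructor
            · exact fun h => h.1.2
            · rintro rfl
              simp
          simp [coeff_rescale, indepSeries, this]
        rw [coeff_mul, Finset.Nat.antidiagonal_zero, sum_singleton, hI, one_mul, coeff_zero_one] at this
        exact this
      have hA0 : coeff 0 A = 1 := by
        rw [coeff_zero_eq_constantCoeff_apply, hA, map_prod]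
        refine prod_eq_one fun L hL => ?_
        simp [hpos L hL]
      rw [coeff_mul, Finset.Nat.antidiagonal_zero, sum_singleton, hF0, hA0, one_mul]
    · rw [euler_mul, h1, h3]
      ring
    · intro n hn
      rw [map_sub, coeff_sum_multiples W hn, hP, coeff_mk, sub_self]
  have h5 : TruncEq N (PowerSeries.rescale (-1) (indepSeries G W)) A := by
    have := (TruncEq.refl N (PowerSeries.rescale (-1) (indepSeries G W))).mul h4
    rw [mul_one, mul_comm A F, ← mul_assoc, h2, one_mul] at this
    exact this.symm
  have h6 := h5.rescale (-1)
  rw [rescale_rescale, neg_one_mul, neg_neg, rescale_one, RingHom.id_apply, hA, map_prod] at h6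
  refine h6.trans ?_
  have : ∀ L : Heap G, PowerSeries.rescale (-1 : ℚ) (1 - X ^ L.size) = 1 - (-X) ^ L.size := by
    intro L
    rw [map_sub, map_one, map_pow, rescale_X]
    simp
  simp only [this]
  exact TruncEq.refl _ _

open Classical in
/-- The pairs of a part `k ≤ N` and a Lyndon heap on `W` attachable to it. -/
noncomputable def lynPairs (G : SimpleGraph V) (W : Finset V) (N : ℕ) : Finset (ℕ × Heap G) :=
  (range (N + 1) ×ˢ lynUpTo G W N).filter Attachable

theorem mem_lynPairs {W : Finset V} {N : ℕ} {x : ℕ × Heap G} :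
    x ∈ lynPairs G W N ↔ x.1 ≤ N ∧ (∀ v ∈ x.2.type, v ∈ W) ∧ x.2.IsLyndon ∧ Attachable x := by
  classical
  rw [lynPairs, mem_filter, mem_product, mem_range, mem_lynUpTo]
  constructor
  · rintro ⟨⟨h1, -, h2, h3⟩, h4⟩
    exact ⟨by omega, h2, h3, h4⟩
  · rintro ⟨h1, h2, h3, h4⟩
    exact ⟨⟨by omega, h4.size_le.trans h1, h2, h3⟩, h4⟩

/-- Proved one heap at a time. A heap of odd size is attachable only to its size and gives the
matching factor on the right; one of even size is attachable only to even parts, whose factors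
cancel `1 - X ^ L.size`. Keeping these on the left avoids denominators. -/
theorem truncEq_indepSeries_mul (W : Finset V) (N : ℕ) :
    TruncEq N (indepSeries G W * ∏ x ∈ lynPairs G W N with Even x.1, (1 + X ^ x.1))
      (∏ x ∈ lynPairs G W N with Odd x.1, (1 + X ^ x.1)) := by
  classical
  have hpos : ∀ L ∈ lynUpTo G W N, L.size ≠ 0 := fun L hL h0 =>
    (mem_lynUpTo.1 hL).2.2.ne_one (eq_one_of_size_eq_zero h0)
  have hfib : ∀ (p : ℕ → Prop) [DecidablePred p], ∏ x ∈ lynPairs G W N with p x.1, (1 + X ^ x.1 : ℚ⟦X⟧) =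
      ∏ L ∈ lynUpTo G W N, ∏ k ∈ range (N + 1) with Attachable (k, L) ∧ p k, (1 + X ^ k) := by
    intro p _
    rw [lynPairs, filter_filter, prod_filter, prod_product_right]
    simp only [prod_filter]
  rw [hfib, hfib]
  refine ((truncEq_indepSeries W N).mul (TruncEq.refl N _)).trans ?_
  rw [← prod_mul_distrib]
  refine TruncEq.prod _ fun L hL => ?_
  rcases Nat.even_or_odd L.size with he | ho
  · have h1 : (range (N + 1)).filter (fun k => Attachable (k, L) ∧ Even k) =
        (range (N + 1)).filter fun k => ∃ j, k = 2 ^ j * L.size := by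
      refine filter_congr fun k _ => ?_
      constructor
      · rintro ⟨h | ⟨-, j, -, h⟩, -⟩
        · exact ⟨0, by simpa using h.symm⟩
        · exact ⟨j, h⟩
      · rintro ⟨j, rfl⟩
        refine ⟨?_, he.mul_left _⟩
        rcases Nat.eq_zero_or_pos j with rfl | hj
        · exact Or.inl (by simp)
        · exact Or.inr ⟨he, j, hj, rfl⟩
    have h2 : (range (N + 1)).filter (fun k => Attachable (k, L) ∧ Odd k) = ∅ := by
      refine filter_eq_empty_iff.2 fun k _ h => ?_
      rcases h with ⟨h | ⟨-, j, -, h⟩, hk⟩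
      · simp only at h
        exact Nat.not_even_iff_odd.2 hk (h ▸ he)
      · simp only at h
        exact Nat.not_even_iff_odd.2 hk (h ▸ he.mul_left _)
    rw [h1, h2, prod_empty, he.neg_pow]
    exact truncEq_one_sub_mul_prod (hpos L hL) N
  · have hatt : ∀ k, Attachable (k, L) ↔ k = L.size := by
      intro k
      constructor
      · rintro (h | ⟨h, -⟩)
        · exact h.symm
        · exact absurd ho (Nat.not_odd_iff_even.2 h)
      · rintro rfl
        exact Or.inl rfl
    have h1 : (range (N + 1)).filter (fun k => Attachable (k, L) ∧ Even k) = ∅ := by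
      refine filter_eq_empty_iff.2 fun k _ h => ?_
      rw [hatt] at h
      exact Nat.not_even_iff_odd.2 ho (h.1 ▸ h.2)
    have h2 : (range (N + 1)).filter (fun k => Attachable (k, L) ∧ Odd k) = {L.size} := by
      ext k
      rw [mem_filter, mem_range, mem_singleton, hatt]
      constructor
      · exact fun h => h.2.1
      · rintro rfl
        have := (mem_lynUpTo.1 hL).1
        exact ⟨by omega, rfl, ho⟩
    rw [h1, h2, prod_empty, prod_singleton, ho.neg_pow, sub_neg_eq_add, mul_one]
    exact TruncEq.refl _ _

end Independence

end Kromatic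

/-! ### From one variable to all variables, and from colorings to independent sets -/

namespace Kromatic

open Heap Finset

/-! ### Products over all variables -/

section Spread

/-- The product `∏ i, f (x i)` for a power series `f` with constant coefficient one. -/
noncomputable def spread (f : PowerSeries ℚ) : MvPowerSeries ℕ ℚ := fun m =>
  m.prod fun _ e => PowerSeries.coeff e f

theorem coeff_spread (f : PowerSeries ℚ) (m : ℕ →₀ ℕ) :
    MvPowerSeries.coeff m (spread f) = ∏ i ∈ m.support, PowerSeries.coeff (m i) f := rfl

theorem coeff_spread_of_subset {f : PowerSeries ℚ} (hf : PowerSeries.coeff 0 f = 1) {m : ℕ →₀ ℕ}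
    {s : Finset ℕ} (hs : m.support ⊆ s) :
    MvPowerSeries.coeff m (spread f) = ∏ i ∈ s, PowerSeries.coeff (m i) f :=
  Finsupp.prod_of_support_subset m hs (fun _ e => PowerSeries.coeff e f) fun _ _ => hf

theorem spread_one : spread 1 = 1 := by
  ext m
  rw [coeff_spread, MvPowerSeries.coeff_one]
  split_ifs with h
  · simp [h]
  · obtain ⟨i, hi⟩ := Finsupp.support_nonempty_iff.2 h
    refine prod_eq_zero hi ?_
    rw [PowerSeries.coeff_one, if_neg (Finsupp.mem_support_iff.1 hi)]

/-- Splitting each exponent of `m` separately is the same as splitting `m`. Constant coefficient one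
lets variables absent from one summand contribute a factor 1. -/
theorem spread_mul {f g : PowerSeries ℚ} (hf : PowerSeries.coeff 0 f = 1)
    (hg : PowerSeries.coeff 0 g = 1) : spread (f * g) = spread f * spread g := by
  classical
  ext m
  rw [coeff_spread, MvPowerSeries.coeff_mul]
  simp only [PowerSeries.coeff_mul]
  rw [prod_sum]
  refine sum_bij' (fun p _ => (Finsupp.indicator m.support fun i hi => (p i hi).1,
    Finsupp.indicator m.support fun i hi => (p i hi).2)) (fun x _ i _ => (x.1 i, x.2 i))
    ?_ ?_ ?_ ?_ ?_
  · intro p hp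
    rw [HasAntidiagonal.mem_antidiagonal]
    ext i
    rw [mem_pi] at hp
    by_cases hi : i ∈ m.support
    · have := hp i hi
      rw [HasAntidiagonal.mem_antidiagonal] at this
      simp only [Finsupp.coe_add, Pi.add_apply, Finsupp.indicator_apply, dif_pos hi, this]
    · simp only [Finsupp.coe_add, Pi.add_apply, Finsupp.indicator_apply, dif_neg hi]
      simpa using (Finsupp.notMem_support_iff.1 hi).symm
  · intro x hx
    rw [HasAntidiagonal.mem_antidiagonal] at hx
    rw [mem_pi]
    intro i _
    rw [HasAntidiagonal.mem_antidiagonal, ← hx]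
    rfl
  · intro p hp
    funext i hi
    simp only [Finsupp.indicator_apply, dif_pos hi]
  · rintro ⟨a, b⟩ hx
    rw [HasAntidiagonal.mem_antidiagonal] at hx
    have h0 : ∀ i ∉ m.support, a i = 0 ∧ b i = 0 := by
      intro i hi
      have := Finsupp.notMem_support_iff.1 hi
      rw [← hx] at this
      exact Nat.add_eq_zero_iff.1 this
    rw [Prod.mk.injEq]
    constructor
    · ext i
      rw [Finsupp.indicator_apply]
      split_ifs with h
      · rfl
      · exact (h0 i h).1.symm
    · ext i
      rw [Finsupp.indicator_apply]
      split_ifs with h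
      · rfl
      · exact (h0 i h).2.symm
  · intro p hp
    rw [coeff_spread_of_subset hf (Finsupp.support_indicator_subset _ _),
      coeff_spread_of_subset hg (Finsupp.support_indicator_subset _ _), ← prod_mul_distrib,
      ← prod_attach m.support]
    refine prod_congr rfl fun i _ => ?_
    simp only [Finsupp.indicator_apply, dif_pos i.2]

theorem spread_prod {ι : Type*} (s : Finset ι) (f : ι → PowerSeries ℚ)
    (h : ∀ i ∈ s, PowerSeries.coeff 0 (f i) = 1) :
    spread (∏ i ∈ s, f i) = ∏ i ∈ s, spread (f i) := by
  classical
  induction s using Finset.induction_on with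
  | empty => simp [spread_one]
  | insert a s ha ih =>
    have h' : ∀ i ∈ s, PowerSeries.coeff 0 (f i) = 1 := fun i hi => h i (mem_insert_of_mem hi)
    rw [prod_insert ha, prod_insert ha, spread_mul (h a (mem_insert_self _ _)), ih h']
    rw [PowerSeries.coeff_zero_eq_constantCoeff_apply, map_prod]
    exact prod_eq_one fun i hi => by
      rw [← PowerSeries.coeff_zero_eq_constantCoeff_apply, h' i hi]

theorem spread_one_add_X_pow (k : ℕ) :
    spread (1 + PowerSeries.X ^ k) = 1 + pbar k := by
  classical
  ext m
  have hL : MvPowerSeries.coeff m (1 + pbar k) =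
      if ∀ i ∈ m.support, m i = k then (1 : ℚ) else 0 := by
    rw [map_add, MvPowerSeries.coeff_one]
    change _ + (if m ≠ 0 ∧ ∀ i ∈ m.support, m i = k then (1 : ℚ) else 0) = _
    by_cases hm : m = 0
    · subst hm
      simp
    · simp [hm]
  rw [hL, coeff_spread, prod_congr rfl (g := fun i => if m i = k then (1 : ℚ) else 0),
    prod_ite_zero, prod_const_one]
  intro i hi
  rw [map_add, PowerSeries.coeff_one, PowerSeries.coeff_X_pow,
    if_neg (Finsupp.mem_support_iff.1 hi), zero_add]

/-- Equality of the coefficients of all monomials of degree at most `N`. -/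
def MvTruncEq (N : ℕ) (f g : MvPowerSeries ℕ ℚ) : Prop :=
  ∀ m : ℕ →₀ ℕ, m.degree ≤ N → MvPowerSeries.coeff m f = MvPowerSeries.coeff m g

theorem MvTruncEq.refl (N : ℕ) (f : MvPowerSeries ℕ ℚ) : MvTruncEq N f f := fun _ _ => rfl

theorem MvTruncEq.symm {N : ℕ} {f g : MvPowerSeries ℕ ℚ} (h : MvTruncEq N f g) :
    MvTruncEq N g f := fun m hm => (h m hm).symm

theorem MvTruncEq.trans {N : ℕ} {f g h : MvPowerSeries ℕ ℚ} (h1 : MvTruncEq N f g)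
    (h2 : MvTruncEq N g h) : MvTruncEq N f h := fun m hm => (h1 m hm).trans (h2 m hm)

theorem MvTruncEq.mul {N : ℕ} {f g f' g' : MvPowerSeries ℕ ℚ} (h : MvTruncEq N f g)
    (h' : MvTruncEq N f' g') : MvTruncEq N (f * f') (g * g') := by
  classical
  intro m hm
  rw [MvPowerSeries.coeff_mul, MvPowerSeries.coeff_mul]
  refine sum_congr rfl fun x hx => ?_
  rw [HasAntidiagonal.mem_antidiagonal] at hx
  rw [← hx, map_add] at hm
  rw [h _ (by omega), h' _ (by omega)]

theorem MvTruncEq.prod {ι : Type*} {N : ℕ} (s : Finset ι) {f g : ι → MvPowerSeries ℕ ℚ}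
    (h : ∀ i ∈ s, MvTruncEq N (f i) (g i)) : MvTruncEq N (∏ i ∈ s, f i) (∏ i ∈ s, g i) := by
  classical
  induction s using Finset.induction_on with
  | empty => exact MvTruncEq.refl _ _
  | insert a s ha ih =>
    rw [prod_insert ha, prod_insert ha]
    exact (h a (mem_insert_self _ _)).mul (ih fun i hi => h i (mem_insert_of_mem hi))

theorem TruncEq.spread {N : ℕ} {f g : PowerSeries ℚ} (h : TruncEq N f g) :
    MvTruncEq N (spread f) (spread g) := by
  intro m hm
  rw [coeff_spread, coeff_spread]
  exact prod_congr rfl fun i _ => h _ ((Finsupp.le_degree i m).trans hm)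

end Spread

/-! ### Inclusion and exclusion -/

section InclusionExclusion

variable {V : Type*} [Fintype V]

theorem sum_inclusion_exclusion [DecidableEq V] {α : Type*} (A : Finset α) (s : α → Finset V)
    (w : α → ℚ) :
    ∑ W : Finset V, (-1 : ℚ) ^ (Wᶜ).card * ∑ a ∈ A with s a ⊆ W, w a =
      ∑ a ∈ A with s a = univ, w a := by
  have key : ∀ S : Finset V, ∑ W : Finset V with S ⊆ W, (-1 : ℚ) ^ (Wᶜ).card =
      if S = univ then 1 else 0 := by
    intro S
    have h1 : ∑ W : Finset V with S ⊆ W, (-1 : ℚ) ^ (Wᶜ).card =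
        ∑ T ∈ (Sᶜ).powerset, (-1 : ℚ) ^ T.card := by
      refine sum_bij' (fun W _ => Wᶜ) (fun T _ => Tᶜ) ?_ ?_ ?_ ?_ ?_
      · intro W hW
        simpa using hW
      · intro T hT
        rw [mem_powerset] at hT
        simpa using subset_compl_comm.1 hT
      · simp
      · simp
      · simp
    rw [h1]
    have h2 := congrArg (Int.cast : ℤ → ℚ) (sum_powerset_neg_one_pow_card (x := Sᶜ))
    push_cast at h2
    rw [h2]
    simp only [compl_eq_empty_iff]
  simp only [sum_filter, mul_sum]
  rw [sum_comm]
  refine sum_congr rfl fun a _ => ?_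
  have h3 := key (s a)
  rw [sum_filter] at h3
  calc ∑ W : Finset V, (-1 : ℚ) ^ (Wᶜ).card * (if s a ⊆ W then w a else 0)
      = (∑ W : Finset V, if s a ⊆ W then (-1 : ℚ) ^ (Wᶜ).card else 0) * w a := by
        rw [sum_mul]
        refine sum_congr rfl fun W _ => ?_
        split_ifs <;> simp
    _ = _ := by
        rw [h3]
        split_ifs <;> simp

variable (G : SimpleGraph V)

theorem colorWeight_apply [DecidableEq V] (κ : V → Finset ℕ) (i : ℕ) :
    colorWeight κ i = (univ.filter fun v => i ∈ κ v).card := by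
  classical
  rw [colorWeight, Finsupp.finsetSum_apply, card_filter]
  refine sum_congr rfl fun v _ => ?_
  rw [Finsupp.finsetSum_apply]
  simp [Finsupp.single_apply]

open Classical in
/-- The set colorings with disjoint sets at adjacent vertices, empty sets being allowed, that give
a certain monomial. -/
noncomputable def partialColorings (m : ℕ →₀ ℕ) : Finset (V → Finset ℕ) :=
  (finite_colorWeight_eq (V := V) m).toFinset.filter fun κ =>
    ∀ u v, G.Adj u v → Disjoint (κ u) (κ v)

theorem mem_partialColorings {m : ℕ →₀ ℕ} {κ : V → Finset ℕ} :
    κ ∈ partialColorings G m ↔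
      colorWeight κ = m ∧ ∀ u v, G.Adj u v → Disjoint (κ u) (κ v) := by
  classical
  simp [partialColorings]

/-- The vertices with a nonempty set of colors. -/
def colored (κ : V → Finset ℕ) : Finset V := univ.filter fun v => (κ v).Nonempty

theorem mem_colored {κ : V → Finset ℕ} {v : V} : v ∈ colored κ ↔ (κ v).Nonempty := by
  simp [colored]

theorem coeff_kromatic [DecidableEq V] (m : ℕ →₀ ℕ) : MvPowerSeries.coeff m (kromatic G) =
    (((partialColorings G m).filter fun κ => colored κ = univ).card : ℚ) := by
  change (Nat.card {κ : V → Finset ℕ // IsProperSetColoring G κ ∧ colorWeight κ = m} : ℚ) = _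
  rw [Nat.subtype_card ((partialColorings G m).filter fun κ => colored κ = univ)]
  intro κ
  rw [mem_filter, mem_partialColorings, eq_univ_iff_forall, IsProperSetColoring]
  simp only [mem_colored]
  tauto

/-- A coloring is the same as a choice, for each color `i`, of the set of vertices carrying it, an
independent set of size `m i`. -/
theorem coeff_spread_indepSeries [DecidableEq V] (W : Finset V) (m : ℕ →₀ ℕ) :
    MvPowerSeries.coeff m (spread (PowerSeries.mk fun k => ((indepOn G W k).card : ℚ))) =
    (((partialColorings G m).filter fun κ => colored κ ⊆ W).card : ℚ) := by
  classical
  rw [coeff_spread]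
  simp only [PowerSeries.coeff_mk]
  rw [← Nat.cast_prod, ← card_pi]
  congr 1
  symm
  refine card_bij' (fun κ _ i _ => univ.filter fun v => i ∈ κ v)
    (fun p _ v => m.support.filter fun i => ∃ h : i ∈ m.support, v ∈ p i h) ?_ ?_ ?_ ?_
  · intro κ hκ
    rw [mem_filter, mem_partialColorings] at hκ
    obtain ⟨⟨rfl, hd⟩, hW⟩ := hκ
    rw [mem_pi]
    intro i hi
    rw [mem_indepOn]
    refine ⟨⟨fun v hv => hW (mem_colored.2 ⟨i, (mem_filter.1 hv).2⟩), ?_⟩,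
      fun u hu v hv huv => ?_⟩
    · rw [colorWeight_apply]
    · exact disjoint_left.1 (hd u v huv) (mem_filter.1 hu).2 (mem_filter.1 hv).2
  · intro p hp
    rw [mem_pi] at hp
    rw [mem_filter, mem_partialColorings]
    refine ⟨⟨?_, fun u v huv => ?_⟩, fun v hv => ?_⟩
    · ext i
      rw [colorWeight_apply]
      by_cases hi : i ∈ m.support
      · have h1 := (mem_indepOn.1 (hp i hi)).1.2
        rw [← h1]
        congr 1
        ext v
        simp only [mem_filter, mem_univ, true_and, hi, exists_true_left]
      · rw [Finsupp.notMem_support_iff.1 hi, card_eq_zero]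
        refine filter_eq_empty_iff.2 fun v _ hv => hi (mem_filter.1 hv).1
    · rw [disjoint_left]
      intro i hiu hiv
      obtain ⟨hi, h1⟩ := (mem_filter.1 hiu).2
      obtain ⟨_, h2⟩ := (mem_filter.1 hiv).2
      exact (mem_indepOn.1 (hp i hi)).2 u h1 v h2 huv
    · obtain ⟨i, hi⟩ := mem_colored.1 hv
      obtain ⟨hi', h1⟩ := (mem_filter.1 hi).2
      exact (mem_indepOn.1 (hp i hi')).1.1 h1
  · intro κ hκ
    rw [mem_filter, mem_partialColorings] at hκ
    obtain ⟨⟨rfl, -⟩, -⟩ := hκ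
    funext v
    ext i
    simp only [mem_filter, mem_univ, true_and, exists_prop]
    constructor
    · exact fun h => h.2.2
    · intro h
      have : i ∈ (colorWeight κ).support := by
        rw [Finsupp.mem_support_iff, colorWeight_apply, Ne, card_eq_zero]
        exact fun h0 => (filter_eq_empty_iff.1 h0) (mem_univ v) h
      exact ⟨this, this, h⟩
  · intro p hp
    funext i hi
    ext v
    simp only [mem_filter, mem_univ, true_and, hi, exists_true_left]

theorem coeff_kromatic_eq_sum [DecidableEq V] (m : ℕ →₀ ℕ) : MvPowerSeries.coeff m (kromatic G) =
    ∑ W : Finset V, (-1 : ℚ) ^ (Wᶜ).card *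
      MvPowerSeries.coeff m (spread (PowerSeries.mk fun k => ((indepOn G W k).card : ℚ))) := by
  have h := sum_inclusion_exclusion (partialColorings G m) colored fun _ => 1
  simp only [sum_const, nsmul_eq_mul, mul_one] at h
  rw [coeff_kromatic, ← h]
  exact sum_congr rfl fun W _ => by rw [coeff_spread_indepSeries]

end InclusionExclusion

end Kromatic

/-! ### Expansion into products of the `p̄ k`, indexed by multisets of Lyndon heaps -/

namespace Kromatic

open Heap Finset

/-! ### Degrees of products of the `p̄ k` -/

section Degree

theorem card_parts_le {n : ℕ} (μ : n.Partition) : μ.parts.card ≤ n := by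
  have h := Multiset.card_nsmul_le_sum (s := μ.parts) (a := 1) fun x hx => μ.parts_pos hx
  rw [μ.parts_sum] at h
  simpa using h

theorem coeff_pbar_ne_zero {k : ℕ} {m : ℕ →₀ ℕ} (h : MvPowerSeries.coeff m (pbar k) ≠ 0) :
    m ≠ 0 ∧ ∀ i ∈ m.support, m i = k := by
  classical
  by_contra h'
  exact h (if_neg h')

theorem coeff_pbar_nonneg (k : ℕ) (m : ℕ →₀ ℕ) : 0 ≤ MvPowerSeries.coeff m (pbar k) := by
  classical
  change (0 : ℚ) ≤ if m ≠ 0 ∧ ∀ i ∈ m.support, m i = k then 1 else 0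
  split_ifs <;> norm_num

theorem degree_eq_card_mul_of_forall_eq {k : ℕ} {m : ℕ →₀ ℕ} (h : ∀ i ∈ m.support, m i = k) :
    m.degree = m.support.card * k := by
  rw [Finsupp.degree_apply, sum_congr rfl h, sum_const, smul_eq_mul]

theorem exists_of_coeff_mul_ne_zero {f g : MvPowerSeries ℕ ℚ} {m : ℕ →₀ ℕ}
    (h : MvPowerSeries.coeff m (f * g) ≠ 0) : ∃ a b, a + b = m ∧
      MvPowerSeries.coeff a f ≠ 0 ∧ MvPowerSeries.coeff b g ≠ 0 := by
  classical
  rw [MvPowerSeries.coeff_mul] at h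
  obtain ⟨x, hx, hne⟩ := exists_ne_zero_of_sum_ne_zero h
  rw [HasAntidiagonal.mem_antidiagonal] at hx
  exact ⟨x.1, x.2, hx, left_ne_zero_of_mul hne, right_ne_zero_of_mul hne⟩

/-- Each factor contributes at least one variable to the power `k`. This bound makes all the sums
over partitions finite. -/
theorem sum_le_degree_of_coeff_ne_zero {s : Multiset ℕ} {m : ℕ →₀ ℕ}
    (h : MvPowerSeries.coeff m (s.map pbar).prod ≠ 0) : s.sum ≤ m.degree := by
  induction s using Multiset.induction_on generalizing m with
  | empty => simp
  | cons k s ih =>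
    rw [Multiset.map_cons, Multiset.prod_cons] at h
    obtain ⟨a, b, rfl, ha, hb⟩ := exists_of_coeff_mul_ne_zero h
    rw [Multiset.sum_cons, map_add]
    refine add_le_add ?_ (ih hb)
    obtain ⟨h0, h1⟩ := coeff_pbar_ne_zero ha
    rw [degree_eq_card_mul_of_forall_eq h1]
    exact Nat.le_mul_of_pos_left _ (card_pos.2 (Finsupp.support_nonempty_iff.2 h0))

theorem truncEq_geometric {k : ℕ} (hk : k ≠ 0) (N : ℕ) :
    MvTruncEq N ((1 + pbar k) * ∑ j ∈ range (N + 1), (-pbar k) ^ j) 1 := by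
  have h1 : (1 + pbar k) * ∑ j ∈ range (N + 1), (-pbar k) ^ j = 1 - (-pbar k) ^ (N + 1) := by
    rw [← mul_neg_geom_sum (-pbar k) (N + 1), sub_neg_eq_add]
  rw [h1]
  intro m hm
  rw [map_sub, sub_eq_self, neg_pow, ← map_one MvPowerSeries.C, ← map_neg, ← map_pow,
    MvPowerSeries.coeff_C_mul]
  refine mul_eq_zero_of_right _ ?_
  by_contra hne
  have h2 := sum_le_degree_of_coeff_ne_zero (s := Multiset.replicate (N + 1) k) (m := m)
    (by rwa [Multiset.map_replicate, Multiset.prod_replicate])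
  rw [Multiset.sum_replicate, smul_eq_mul] at h2
  have : N + 1 ≤ (N + 1) * k := Nat.le_mul_of_pos_right _ (Nat.pos_of_ne_zero hk)
  omega

end Degree

/-! ### Expanding products of truncated geometric series -/

section Expand

variable {α : Type*}

open Classical in
/-- The multisets over `T` in which every `x` has multiplicity less than `b x`. -/
noncomputable def boundedMultisets (T : Finset α) (b : α → ℕ) : Finset (Multiset α) :=
  (T.pi fun x => range (b x)).image fun g => ∑ x ∈ T.attach, g x.1 x.2 • ({x.1} : Multiset α)

theorem count_sum_attach [DecidableEq α] (T : Finset α) (g : ∀ x ∈ T, ℕ) (y : α) :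
    (∑ x ∈ T.attach, g x.1 x.2 • ({x.1} : Multiset α)).count y =
      if h : y ∈ T then g y h else 0 := by
  rw [Multiset.count_sum']
  simp only [Multiset.count_nsmul, Multiset.count_singleton, mul_ite, mul_one, mul_zero]
  split_ifs with h
  · rw [sum_eq_single ⟨y, h⟩]
    · simp
    · intro x _ hx
      rw [if_neg]
      rintro rfl
      exact hx rfl
    · exact fun h' => absurd (mem_attach _ _) h'
  · refine sum_eq_zero fun x _ => if_neg ?_
    rintro rfl
    exact h x.2

theorem mem_boundedMultisets [inst : DecidableEq α] {T : Finset α} {b : α → ℕ} {P : Multiset α} :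
    P ∈ boundedMultisets T b ↔ (∀ x ∈ P, x ∈ T) ∧ ∀ x ∈ T, P.count x < b x := by
  obtain rfl : inst = fun a b => Classical.propDecidable (a = b) := Subsingleton.elim _ _
  classical
  rw [boundedMultisets, mem_image]
  constructor
  · rintro ⟨g, hg, rfl⟩
    rw [mem_pi] at hg
    constructor
    · intro x hx
      by_contra hxT
      rw [← Multiset.count_pos, count_sum_attach, dif_neg hxT] at hx
      exact lt_irrefl _ hx
    · intro x hx
      rw [count_sum_attach, dif_pos hx]
      exact mem_range.1 (hg x hx)
  · rintro ⟨h1, h2⟩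
    refine ⟨fun x _ => P.count x, mem_pi.2 fun x hx => mem_range.2 (h2 x hx), ?_⟩
    ext y
    refine (count_sum_attach T (fun x _ => P.count x) y).trans ?_
    split_ifs with h
    · rfl
    · exact (Multiset.count_eq_zero.2 fun hy => h (h1 y hy)).symm

theorem prod_sum_range_pow {R : Type*} [CommSemiring R] (T : Finset α) (b : α → ℕ) (f : α → R) :
    ∏ x ∈ T, ∑ j ∈ range (b x), f x ^ j = ∑ P ∈ boundedMultisets T b, (P.map f).prod := by
  classical
  rw [prod_sum, boundedMultisets, sum_image]
  · refine sum_congr rfl fun g _ => ?_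
    rw [← Multiset.coe_mapAddMonoidHom, map_sum, Multiset.prod_sum]
    refine prod_congr rfl fun x _ => ?_
    rw [Multiset.coe_mapAddMonoidHom, Multiset.map_nsmul, Multiset.prod_nsmul]
    simp
  · intro g _ g' _ h
    funext x hx
    have := congrArg (Multiset.count x) h
    simpa only [count_sum_attach, dif_pos hx] using this

end Expand

/-! ### Existence of the expansion -/

section Existence

variable {V : Type*} (G : SimpleGraph V)

/-- The sign attached to a part. -/
def partSign (k : ℕ) : ℚ := if Even k then -1 else 1

theorem partSign_eq (k : ℕ) : partSign k = (-1) ^ (k + 1) := by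
  rw [partSign]
  split_ifs with h
  · rw [h.add_one.neg_one_pow]
  · rw [(Nat.not_even_iff_odd.1 h).add_one.neg_one_pow]

theorem prod_partSign (s : Multiset ℕ) : (s.map partSign).prod = (-1) ^ (s.sum + s.card) := by
  induction s using Multiset.induction_on with
  | empty => simp
  | cons k s ih =>
    rw [Multiset.map_cons, Multiset.prod_cons, ih, partSign_eq, ← pow_add, Multiset.sum_cons,
      Multiset.card_cons]
    congr 1
    omega

/-- The bound on the multiplicity of a pair in degrees up to `N`. -/
def multBound (N : ℕ) (x : ℕ × Heap G) : ℕ := if Even x.1 then N + 1 else 2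

theorem prod_map_sign_mul_pbar (P : Multiset (ℕ × Heap G)) (m : ℕ →₀ ℕ) :
    MvPowerSeries.coeff m (P.map fun x => MvPowerSeries.C (partSign x.1) * pbar x.1).prod =
      (-1) ^ ((P.map Prod.fst).sum + P.card) *
        MvPowerSeries.coeff m ((P.map Prod.fst).map pbar).prod := by
  have h1 : (P.map fun x => MvPowerSeries.C (partSign x.1)).prod =
      (MvPowerSeries.C (-1 : ℚ) : MvPowerSeries ℕ ℚ) ^ ((P.map Prod.fst).sum + P.card) := by
    have h := prod_partSign (P.map Prod.fst)
    rw [Multiset.card_map] at h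
    rw [← map_pow, ← h, map_multiset_prod, Multiset.map_map, Multiset.map_map]
    rfl
  rw [Multiset.prod_map_mul, h1, Multiset.map_map, ← map_pow, MvPowerSeries.coeff_C_mul]
  rfl

variable [Fintype V]

open Classical in
/-- The vertices used by the heaps in a multiset of pairs. -/
noncomputable def usedVertices (P : Multiset (ℕ × Heap G)) : Finset V :=
  univ.filter fun v => ∃ x ∈ P, v ∈ x.2.type

theorem mem_usedVertices {P : Multiset (ℕ × Heap G)} {v : V} :
    v ∈ usedVertices G P ↔ ∃ x ∈ P, v ∈ x.2.type := by
  classical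
  simp [usedVertices]

variable [LinearOrder V]

/-- An odd `k` contributes `1 + pbar k`, whence multiplicities below 2; an even `k` contributes the
inverse of `1 + pbar k`, a geometric series of which `N + 1` terms suffice. -/
theorem truncEq_spread_indepSeries (W : Finset V) (N : ℕ) :
    MvTruncEq N (spread (indepSeries G W)) (∑ P ∈ boundedMultisets (lynPairs G W N) (multBound G N),
      (P.map fun x => MvPowerSeries.C (partSign x.1) * pbar x.1).prod) := by
  classical
  have hpos : ∀ x ∈ lynPairs G W N, x.1 ≠ 0 := by
    intro x hx h0
    rw [mem_lynPairs] at hx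
    have h1 := hx.2.2.2.size_le
    exact hx.2.2.1.ne_one (eq_one_of_size_eq_zero (by omega))
  have hcoeff : ∀ x ∈ lynPairs G W N, PowerSeries.coeff 0 (1 + PowerSeries.X ^ x.1 : PowerSeries ℚ)
      = 1 := by
    intro x hx
    simp [hpos x hx]
  have hI : PowerSeries.coeff 0 (indepSeries G W) = 1 := by
    have : indepOn G W 0 = {∅} := by
      ext S
      rw [mem_indepOn, mem_singleton, card_eq_zero]
      constructor
      · exact fun h => h.1.2
      · rintro rfl
        simp
    simp [indepSeries, this]
  have hE : PowerSeries.coeff 0 (∏ x ∈ lynPairs G W N with Even x.1,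
      (1 + PowerSeries.X ^ x.1 : PowerSeries ℚ)) = 1 := by
    rw [PowerSeries.coeff_zero_eq_constantCoeff_apply, map_prod]
    exact prod_eq_one fun x hx => by
      rw [← PowerSeries.coeff_zero_eq_constantCoeff_apply, hcoeff x (mem_filter.1 hx).1]
  have h1 := (truncEq_indepSeries_mul (G := G) W N).spread
  rw [spread_mul hI hE, spread_prod _ _ fun x hx => hcoeff x (mem_filter.1 hx).1,
    spread_prod _ _ fun x hx => hcoeff x (mem_filter.1 hx).1] at h1
  simp only [spread_one_add_X_pow] at h1
  have h2 : MvTruncEq N (∏ x ∈ lynPairs G W N with Even x.1,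
      ((1 + pbar x.1) * ∑ j ∈ range (N + 1), (-pbar x.1) ^ j)) (∏ x ∈ lynPairs G W N with Even x.1,
      1) :=
    MvTruncEq.prod _ fun x hx => truncEq_geometric (hpos x (mem_filter.1 hx).1) N
  rw [prod_mul_distrib, prod_const_one] at h2
  have h3 := (MvTruncEq.refl N (spread (indepSeries G W))).mul h2
  rw [mul_one, ← mul_assoc] at h3
  refine h3.symm.trans ((h1.mul (MvTruncEq.refl N _)).trans ?_)
  rw [← prod_sum_range_pow, ← prod_filter_mul_prod_filter_not (lynPairs G W N) fun x => Even x.1,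
    mul_comm]
  simp only [Nat.not_even_iff_odd]
  have he : ∏ x ∈ lynPairs G W N with Even x.1, ∑ j ∈ range (N + 1), (-pbar x.1) ^ j =
      ∏ x ∈ lynPairs G W N with Even x.1, ∑ j ∈ range (multBound G N x),
        (MvPowerSeries.C (partSign x.1) * pbar x.1) ^ j := by
    refine prod_congr rfl fun x hx => ?_
    have := (mem_filter.1 hx).2
    rw [multBound, partSign, if_pos this, if_pos this, map_neg, map_one, neg_one_mul]
  have ho : ∏ x ∈ lynPairs G W N with Odd x.1, (1 + pbar x.1) =
      ∏ x ∈ lynPairs G W N with Odd x.1, ∑ j ∈ range (multBound G N x),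
        (MvPowerSeries.C (partSign x.1) * pbar x.1) ^ j := by
    refine prod_congr rfl fun x hx => ?_
    have := Nat.not_even_iff_odd.2 (mem_filter.1 hx).2
    rw [multBound, partSign, if_neg this, if_neg this, map_one, one_mul]
    simp [sum_range_succ]
  rw [he, ho]
  exact MvTruncEq.refl _ _

/-- All `W` share one index set and differ only by a condition on used vertices, the form needed for
inclusion and exclusion. -/
theorem boundedMultisets_lynPairs (W : Finset V) (N : ℕ) :
    boundedMultisets (lynPairs G W N) (multBound G N) =
      (boundedMultisets (lynPairs G univ N) (multBound G N)).filter
        fun P => usedVertices G P ⊆ W := by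
  classical
  ext P
  rw [mem_filter, mem_boundedMultisets, mem_boundedMultisets]
  have hsub : ∀ x, x ∈ lynPairs G W N ↔
      x ∈ lynPairs G univ N ∧ ∀ v ∈ x.2.type, v ∈ W := by
    intro x
    simp only [mem_lynPairs, mem_univ, implies_true, true_and]
    tauto
  constructor
  · rintro ⟨h1, h2⟩
    refine ⟨⟨fun x hx => ((hsub x).1 (h1 x hx)).1, fun x hx => ?_⟩, fun v hv => ?_⟩
    · by_cases hxP : x ∈ P
      · exact h2 x (h1 x hxP)
      · rw [Multiset.count_eq_zero.2 hxP, multBound]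
        split_ifs <;> omega
    · obtain ⟨x, hx, hv⟩ := (mem_usedVertices G).1 hv
      exact ((hsub x).1 (h1 x hx)).2 v hv
  · rintro ⟨⟨h1, h2⟩, h3⟩
    exact ⟨fun x hx => (hsub x).2 ⟨h1 x hx, fun v hv =>
      h3 ((mem_usedVertices G).2 ⟨x, hx, hv⟩)⟩, fun x hx => h2 x ((hsub x).1 hx).1⟩

theorem coeff_kromatic_eq_sum_multisets {N : ℕ} {m : ℕ →₀ ℕ} (hm : m.degree ≤ N) :
    MvPowerSeries.coeff m (kromatic G) =
      ∑ P ∈ boundedMultisets (lynPairs G univ N) (multBound G N) with usedVertices G P = univ,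
        (-1) ^ ((P.map Prod.fst).sum + P.card) *
          MvPowerSeries.coeff m ((P.map Prod.fst).map pbar).prod := by
  rw [coeff_kromatic_eq_sum, ← sum_inclusion_exclusion]
  refine sum_congr rfl fun W _ => ?_
  have h := truncEq_spread_indepSeries G W N m hm
  rw [map_sum, boundedMultisets_lynPairs] at h
  simp only [prod_map_sign_mul_pbar] at h
  rw [← h]
  rfl

theorem mem_lyndonCoverings_iff {n N : ℕ} (hn : n ≤ N) (μ : n.Partition)
    {P : Multiset (ℕ × Heap G)} : P ∈ lyndonCoverings G μ ↔
      P.map Prod.fst = μ.parts ∧ P ∈ boundedMultisets (lynPairs G univ N) (multBound G N) ∧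
        usedVertices G P = univ := by
  classical
  have hodd : (∀ k : ℕ, Odd k → (P.filter fun x => x.1 = k).Nodup) ↔
      ∀ x : ℕ × Heap G, Odd x.1 → P.count x ≤ 1 := by
    constructor
    · intro h x hx
      have := Multiset.nodup_iff_count_le_one.1 (h x.1 hx) x
      rwa [Multiset.count_filter_of_pos (p := fun y : ℕ × Heap G => y.1 = x.1) rfl] at this
    · intro h k hk
      rw [Multiset.nodup_iff_count_le_one]
      intro x
      rw [Multiset.count_filter]
      split_ifs with hx
      · exact h x (hx ▸ hk)
      · exact Nat.zero_le _
  change (P.map Prod.fst = μ.parts ∧ (∀ x ∈ P, x.2.IsLyndon ∧ Attachable x) ∧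
    (∀ k : ℕ, Odd k → (P.filter fun x => x.1 = k).Nodup) ∧ ∀ v : V, ∃ x ∈ P, v ∈ x.2.type) ↔ _
  rw [hodd, mem_boundedMultisets, eq_univ_iff_forall]
  simp only [mem_usedVertices]
  refine and_congr_right fun hμ => ?_
  rw [← and_assoc]
  refine and_congr_left fun _ => ?_
  -- The bound on even multiplicities is no restriction, as there are at most `n ≤ N` parts.
  have hcard : P.card ≤ N := by
    rw [← Multiset.card_map Prod.fst, hμ]
    exact (card_parts_le μ).trans hn
  constructor
  · rintro ⟨h1, h2⟩
    refine ⟨fun x hx => ?_, fun x _ => ?_⟩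
    · rw [mem_lynPairs]
      refine ⟨?_, by simp, (h1 x hx).1, (h1 x hx).2⟩
      have hmem : x.1 ∈ μ.parts := by
        rw [← hμ]
        exact Multiset.mem_map_of_mem _ hx
      have := Multiset.le_sum_of_mem hmem
      rw [μ.parts_sum] at this
      exact this.trans hn
    · rw [multBound]
      split_ifs with he
      · have := Multiset.count_le_card x P
        omega
      · have := h2 x (Nat.not_even_iff_odd.1 he)
        omega
  · rintro ⟨h1, h2⟩
    refine ⟨fun x hx => ?_, fun x hx => ?_⟩
    · have := mem_lynPairs.1 (h1 x hx)
      exact ⟨this.2.2.1, this.2.2.2⟩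
    · by_cases hxP : x ∈ P
      · have := h2 x (h1 x hxP)
        rw [multBound, if_neg (Nat.not_even_iff_odd.2 hx)] at this
        omega
      · rw [Multiset.count_eq_zero.2 hxP]
        exact Nat.zero_le _

theorem lyndonCoverings_finite {n : ℕ} (μ : n.Partition) : (lyndonCoverings G μ).Finite :=
  (boundedMultisets (lynPairs G univ n) (multBound G n)).finite_toSet.subset fun _ hP =>
    ((mem_lyndonCoverings_iff G le_rfl μ).1 hP).2.1

/-- The partitions of size at most `N`. -/
def partitionsUpTo (N : ℕ) : Finset (Σ n : ℕ, n.Partition) :=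
  (range (N + 1)).sigma fun _ => univ

theorem support_subset_partitionsUpTo (c : (n : ℕ) → n.Partition → ℚ) (m : ℕ →₀ ℕ) :
    (Function.support fun x : Σ n : ℕ, n.Partition =>
      c x.1 x.2 * MvPowerSeries.coeff m (pbarPart x.2)) ⊆ partitionsUpTo m.degree := by
  intro x hx
  have := sum_le_degree_of_coeff_ne_zero (right_ne_zero_of_mul hx)
  rw [x.2.parts_sum] at this
  rw [mem_coe, partitionsUpTo, mem_sigma, mem_range]
  exact ⟨by omega, mem_univ _⟩

theorem isPbarExpansion_iff (f : MvPowerSeries ℕ ℚ) (c : (n : ℕ) → n.Partition → ℚ) :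
    IsPbarExpansion f c ↔ ∀ m, MvPowerSeries.coeff m f =
      ∑ x ∈ partitionsUpTo m.degree, c x.1 x.2 * MvPowerSeries.coeff m (pbarPart x.2) := by
  refine forall_congr' fun m => ?_
  rw [finsum_eq_sum_of_support_subset _ (support_subset_partitionsUpTo c m), and_iff_right]
  exact (finite_toSet _).subset (support_subset_partitionsUpTo c m)

theorem isPbarExpansion_kromatic : IsPbarExpansion (kromatic G) fun n μ =>
    (-1) ^ (n + μ.parts.card) * ((lyndonCoverings G μ).ncard : ℚ) := by
  classical
  rw [isPbarExpansion_iff]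
  intro m
  set N := m.degree with hN
  rw [coeff_kromatic_eq_sum_multisets G (N := N) le_rfl]
  have h1 : ∀ x : Σ n : ℕ, n.Partition, (-1 : ℚ) ^ (x.1 + x.2.parts.card) *
      ((lyndonCoverings G x.2).ncard : ℚ) * MvPowerSeries.coeff m (pbarPart x.2) =
      ∑ P ∈ (lyndonCoverings_finite G x.2).toFinset,
        (-1) ^ ((P.map Prod.fst).sum + P.card) *
          MvPowerSeries.coeff m ((P.map Prod.fst).map pbar).prod := by
    intro x
    have hc : ∀ P ∈ (lyndonCoverings_finite G x.2).toFinset,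
        (-1 : ℚ) ^ ((P.map Prod.fst).sum + P.card) *
          MvPowerSeries.coeff m ((P.map Prod.fst).map pbar).prod =
        (-1 : ℚ) ^ (x.1 + x.2.parts.card) * MvPowerSeries.coeff m (pbarPart x.2) := by
      intro P hP
      have hP' : P.map Prod.fst = x.2.parts := ((Set.Finite.mem_toFinset _).1 hP).1
      rw [← Multiset.card_map Prod.fst P, hP', x.2.parts_sum]
      rfl
    rw [sum_congr rfl hc, sum_const, nsmul_eq_mul, Set.ncard_eq_toFinset_card _
      (lyndonCoverings_finite G x.2)]
    ring
  simp only [h1]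
  rw [sum_sigma']
  symm
  refine sum_of_injOn (fun y => y.2) ?_ ?_ ?_ ?_
  · rintro ⟨⟨n, μ⟩, P⟩ hx ⟨⟨n', μ'⟩, P'⟩ hx' h
    simp only [mem_coe, mem_sigma, Set.Finite.mem_toFinset] at hx hx' h
    subst h
    have e1 : P.map Prod.fst = μ.parts := hx.2.1
    have e2 : P.map Prod.fst = μ'.parts := hx'.2.1
    have hn : n = n' := by rw [← μ.parts_sum, ← μ'.parts_sum, ← e1, ← e2]
    subst hn
    have hμ : μ = μ' := Nat.Partition.ext (e1.symm.trans e2)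
    subst hμ
    rfl
  · rintro ⟨⟨n, μ⟩, P⟩ hx
    simp only [mem_coe, mem_sigma, Set.Finite.mem_toFinset, partitionsUpTo, mem_range] at hx
    have := (mem_lyndonCoverings_iff G (show n ≤ N by omega) μ).1 hx.2
    simpa only [coe_filter, Set.mem_ofPred_eq] using this.2
  -- Multisets not coming from a partition of size at most `N` have parts summing to more than the
  -- degree of `m`, so their terms vanish.
  · intro P hP hnot
    refine mul_eq_zero_of_right _ ?_
    by_contra hne
    apply hnot
    have hsum := sum_le_degree_of_coeff_ne_zero hne
    rw [mem_filter] at hP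
    have hpos : ∀ {i}, i ∈ P.map Prod.fst → 0 < i := by
      intro i hi
      obtain ⟨x, hx, rfl⟩ := Multiset.mem_map.1 hi
      have hx' := mem_lynPairs.1 ((mem_boundedMultisets.1 hP.1).1 x hx)
      exact (size_pos hx'.2.2.1.ne_one).trans_le hx'.2.2.2.size_le
    refine ⟨⟨⟨(P.map Prod.fst).sum, ⟨P.map Prod.fst, hpos, rfl⟩⟩, P⟩, ?_, rfl⟩
    simp only [mem_coe, mem_sigma, Set.Finite.mem_toFinset, partitionsUpTo, mem_range]
    refine ⟨⟨by omega, mem_univ _⟩, ?_⟩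
    exact (mem_lyndonCoverings_iff G hsum _).2 ⟨rfl, hP⟩
  · intro y _
    rfl

end Existence

end Kromatic

/-! ### Triangularity of the products of the `p̄ k`, and the conclusion -/

namespace Kromatic

open Finset

/-! ### Uniqueness of the expansion -/

section Uniqueness

theorem coeff_prod_pbar_nonneg (s : Multiset ℕ) (m : ℕ →₀ ℕ) :
    0 ≤ MvPowerSeries.coeff m (s.map pbar).prod := by
  classical
  induction s using Multiset.induction_on generalizing m with
  | empty =>
    rw [Multiset.map_zero, Multiset.prod_zero, MvPowerSeries.coeff_one]
    split_ifs <;> norm_num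
  | cons k s ih =>
    rw [Multiset.map_cons, Multiset.prod_cons, MvPowerSeries.coeff_mul]
    exact sum_nonneg fun x _ => mul_nonneg (coeff_pbar_nonneg _ _) (ih _)

/-- The multiset of nonzero exponents of a monomial. -/
def exponents (m : ℕ →₀ ℕ) : Multiset ℕ := m.support.val.map m

theorem exponents_add_of_disjoint {a b : ℕ →₀ ℕ} (h : Disjoint a.support b.support) :
    exponents (a + b) = exponents a + exponents b := by
  classical
  have hval : (a.support ∪ b.support).val = a.support.val + b.support.val := by
    rw [← disjUnion_eq_union _ _ h]
    rfl
  rw [exponents, Finsupp.support_add_eq h, hval, Multiset.map_add, exponents, exponents]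
  congr 1
  · refine Multiset.map_congr rfl fun i hi => ?_
    rw [Finsupp.add_apply, Finsupp.notMem_support_iff.1 (disjoint_left.1 h hi), add_zero]
  · refine Multiset.map_congr rfl fun i hi => ?_
    rw [Finsupp.add_apply, Finsupp.notMem_support_iff.1 (disjoint_right.1 h hi), zero_add]

theorem exponents_single (i : ℕ) {k : ℕ} (hk : k ≠ 0) :
    exponents (Finsupp.single i k) = {k} := by
  rw [exponents, Finsupp.support_single i hk]
  simp

/-- In lowest degree, a monomial occurring in a product of `p̄ k` has at most as many variables as
there are factors, and when their numbers agree the exponents are the indices. -/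
theorem exponents_of_coeff_ne_zero {s : Multiset ℕ} (hs : ∀ k ∈ s, k ≠ 0) {m : ℕ →₀ ℕ}
    (h : MvPowerSeries.coeff m (s.map pbar).prod ≠ 0) (hdeg : m.degree = s.sum) :
    m.support.card ≤ s.card ∧ (m.support.card = s.card → exponents m = s) := by
  classical
  induction s using Multiset.induction_on generalizing m with
  | empty =>
    rw [Multiset.map_zero, Multiset.prod_zero, MvPowerSeries.coeff_one] at h
    have hm : m = 0 := by
      by_contra hm
      exact h (if_neg hm)
    subst hm
    exact ⟨le_rfl, fun _ => rfl⟩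
  | cons k s ih =>
    rw [Multiset.map_cons, Multiset.prod_cons] at h
    obtain ⟨a, b, rfl, ha, hb⟩ := exists_of_coeff_mul_ne_zero h
    obtain ⟨ha0, hak⟩ := coeff_pbar_ne_zero ha
    have hk : k ≠ 0 := hs k (Multiset.mem_cons_self k s)
    have h1 := degree_eq_card_mul_of_forall_eq hak
    have h2 := card_pos.2 (Finsupp.support_nonempty_iff.2 ha0)
    have h3 := sum_le_degree_of_coeff_ne_zero hb
    rw [map_add, Multiset.sum_cons] at hdeg
    -- In lowest degree no factor `pbar k` can use two variables.
    have h4 : a.support.card = 1 := by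
      by_contra h5
      have h6 : 2 * k ≤ a.support.card * k := Nat.mul_le_mul_right k (by omega)
      omega
    have h5 : b.degree = s.sum := by
      rw [h1, h4] at hdeg
      omega
    obtain ⟨ih1, ih2⟩ := ih (fun k hk => hs k (Multiset.mem_cons_of_mem hk)) hb h5
    have h6 : (a + b).support.card ≤ a.support.card + b.support.card :=
      (card_le_card Finsupp.support_add).trans (card_union_le _ _)
    rw [Multiset.card_cons]
    refine ⟨by omega, fun hcard => ?_⟩
    have hdisj : Disjoint a.support b.support := by
      rw [← card_union_eq_card_add_card]
      have := card_le_card (Finsupp.support_add (g₁ := a) (g₂ := b))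
      have := card_union_le a.support b.support
      omega
    rw [exponents_add_of_disjoint hdisj, ih2 (by omega), ← Multiset.singleton_add]
    congr 1
    obtain ⟨i, hi⟩ := card_eq_one.1 h4
    rw [exponents, hi]
    simp [hak i (by rw [hi]; exact mem_singleton_self i)]

/-- Each factor is given a fresh variable; coefficients are nonnegative, so nothing cancels. -/
theorem exists_exponents_eq {s : Multiset ℕ} (hs : ∀ k ∈ s, k ≠ 0) :
    ∃ m : ℕ →₀ ℕ, exponents m = s ∧ MvPowerSeries.coeff m (s.map pbar).prod ≠ 0 := by
  classical
  induction s using Multiset.induction_on with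
  | empty => exact ⟨0, rfl, by simp⟩
  | cons k s ih =>
    have hk : k ≠ 0 := hs k (Multiset.mem_cons_self k s)
    obtain ⟨b, hb, hb'⟩ := ih fun k hk => hs k (Multiset.mem_cons_of_mem hk)
    obtain ⟨i, hi⟩ := Infinite.exists_notMem_finset b.support
    have hdisj : Disjoint (Finsupp.single i k).support b.support := by
      rw [Finsupp.support_single i hk]
      exact disjoint_singleton_left.2 hi
    refine ⟨Finsupp.single i k + b, ?_, ?_⟩
    · rw [exponents_add_of_disjoint hdisj, exponents_single i hk, hb, Multiset.singleton_add]
    · rw [Multiset.map_cons, Multiset.prod_cons, MvPowerSeries.coeff_mul]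
      refine (sum_pos' (fun x _ => mul_nonneg (coeff_pbar_nonneg _ _)
        (coeff_prod_pbar_nonneg _ _)) ⟨(Finsupp.single i k, b), ?_, ?_⟩).ne'
      · rw [HasAntidiagonal.mem_antidiagonal]
      · refine mul_pos ?_ ((coeff_prod_pbar_nonneg _ _).lt_of_ne' hb')
        change (0 : ℚ) < if _ then 1 else 0
        rw [if_pos]
        · norm_num
        · refine ⟨by simpa using hk, fun j hj => ?_⟩
          rw [Finsupp.support_single i hk, mem_singleton] at hj
          simp [hj]

theorem degree_eq_sum_exponents (m : ℕ →₀ ℕ) : m.degree = (exponents m).sum := rfl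

theorem card_support_eq_card_exponents (m : ℕ →₀ ℕ) : m.support.card = (exponents m).card := by
  rw [exponents, Multiset.card_map]
  rfl

/-- Induction on the size, then downwards on the number of parts. At a monomial with exponents `μ`,
larger partitions have too high a degree, and another partition of the same size contributes only if
it has more parts than `μ`; the induction hypotheses remove the rest. -/
theorem isPbarExpansion_zero {c : (n : ℕ) → n.Partition → ℚ} (h : IsPbarExpansion 0 c) (n : ℕ)
    (μ : n.Partition) : c n μ = 0 := by
  classical
  rw [isPbarExpansion_iff] at h
  induction n using Nat.strong_induction_on with
  | _ n ih =>
  obtain ⟨l, hl⟩ : ∃ l, l = n - μ.parts.card := ⟨_, rfl⟩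
  induction l using Nat.strong_induction_on generalizing μ with
  | _ l ihl =>
  obtain ⟨m, hm, hm'⟩ := exists_exponents_eq (s := μ.parts) fun k hk => (μ.parts_pos hk).ne'
  have hdeg : m.degree = n := by rw [degree_eq_sum_exponents, hm, μ.parts_sum]
  have h1 := h m
  rw [map_zero, sum_eq_single ⟨n, μ⟩] at h1
  · exact (mul_eq_zero.1 h1.symm).resolve_right hm'
  · rintro ⟨n', ν⟩ hx hne
    rw [partitionsUpTo, mem_sigma, mem_range] at hx
    have hle : n' ≤ n := by
      have := hx.1
      simp only at this
      omega
    rcases hle.lt_or_eq with hlt | rfl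
    · exact mul_eq_zero_of_left (ih n' hlt ν) _
    · by_contra hmul
      have hν := right_ne_zero_of_mul hmul
      obtain ⟨h2, h3⟩ := exponents_of_coeff_ne_zero (fun k hk => (ν.parts_pos hk).ne') hν
        (by rw [hdeg, ν.parts_sum])
      rw [card_support_eq_card_exponents, hm] at h2 h3
      rcases h2.lt_or_eq with h4 | h4
      · have h5 := card_parts_le ν
        exact left_ne_zero_of_mul hmul (ihl (n' - ν.parts.card) (by omega) ν rfl)
      · exact hne (by rw [Nat.Partition.ext (h3 h4)])
  · intro hx
    exact absurd (by rw [partitionsUpTo, mem_sigma, mem_range]; exact ⟨Nat.lt_succ_of_le hdeg.ge, mem_univ _⟩) hx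

theorem IsPbarExpansion.unique {f : MvPowerSeries ℕ ℚ} {c d : (n : ℕ) → n.Partition → ℚ}
    (hc : IsPbarExpansion f c) (hd : IsPbarExpansion f d) : c = d := by
  funext n μ
  refine sub_eq_zero.1 (isPbarExpansion_zero (c := fun n μ => c n μ - d n μ) ?_ n μ)
  rw [isPbarExpansion_iff] at hc hd ⊢
  intro m
  simp only [sub_mul, sum_sub_distrib]
  rw [← hc, ← hd, sub_self, map_zero]

end Uniqueness

end Kromatic

/-- The `p̄`-expansion of the Kromatic symmetric function exists and is unique, and
`(-1)^(|μ| - ℓ(μ))` times the coefficient of `p̄ μ` is the number of coverings of `G` of type `μ` by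
Lyndon heaps. -/
theorem theorem1p2 {V : Type*} [Fintype V] [LinearOrder V] (G : SimpleGraph V) :
    (∀ (n : ℕ) (μ : n.Partition), (Kromatic.lyndonCoverings G μ).Finite) ∧
    (∃! c : (n : ℕ) → n.Partition → ℚ,
      Kromatic.IsPbarExpansion (Kromatic.kromatic G) c) ∧
    ∀ c : (n : ℕ) → n.Partition → ℚ,
      Kromatic.IsPbarExpansion (Kromatic.kromatic G) c →
      ∀ (n : ℕ) (μ : n.Partition),
        (-1 : ℚ) ^ (n - Multiset.card μ.parts) * c n μ =
          ((Kromatic.lyndonCoverings G μ).ncard : ℚ) := by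
  have hexp := Kromatic.isPbarExpansion_kromatic G
  refine ⟨fun n μ => Kromatic.lyndonCoverings_finite G μ, ⟨_, hexp, fun c hc => hc.unique hexp⟩,
    fun c hc n μ => ?_⟩
  rw [hc.unique hexp, ← mul_assoc, ← pow_add]
  -- As there are at most `n` parts, the truncated subtraction is exact and the two sign exponents
  -- add up to `2 * n`.
  have hcard := Kromatic.card_parts_le μ
  have heven : Even (n - μ.parts.card + (n + μ.parts.card)) := ⟨n, by omega⟩
  rw [heven.neg_one_pow, one_mul]
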